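/- For an integer $n\ge 1$ let $G_n(t,s)$ be Green's function of the operator $(-1)^n\frac{d^{2n}}{dt^{2n}}$ on $(-1,1)$ with boundary conditions $\psi(\pm1)=\psi'(\pm1)=\cdots=\psi^{(n-1)}(\pm1)=0$. That is, for each $s\in(-1,1)$ the function $G_n(\cdot,s)$ is $C^{2n-2}$ on $[-1,1]$, is smooth and satisfies $(-1)^n\partial_t^{2n}G_n(t,s)=0$ on each of $[-1,s]$ and $[s,1]$, satisfies the boundary conditions, and its $(2n-1)$-st derivative jumps by $(-1)^n$ at $s$. Let $$(T_nf)(t)=\int_{-1}^1G_n(t,s)f(s)\,ds$$ be the solution operator, acting on (real- or complex-valued) functions in $L^p(-1,1)$, $1\le p\le\infty$, and let $\|T_n\|_{p,p}$ be its operator norm on $L^p(-1,1)$. Put $$a_n=\sqrt2\,(2n)!\,\frac{\Gamma(n+\frac12)}{2\,\Gamma(n+1)\,\Gamma(2n+\frac12)},\qquad R_n={}_3F_2\!\left(\tfrac12,1,-n;1-2n,n+1;1\right)=\sum_{k=0}^n\frac{(1/2)_k(1)_k(-n)_k}{(1-2n)_k(n+1)_k\,k!},\qquad b_n=R_na_n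 .$$ Then: 1. $T_n$ maps $L^p(-1,1)$ into itself for all $n\ge1$ and $p\in[1,\infty]$. 2. $\|T_n\|_{\infty,\infty}=\|T_n\|_{1,1}=\dfrac1{(2n)!}$ for all $n\ge1$. 3. $a_n\to1$ and $b_n\to1$ as $n\to\infty$, and for all $n\ge1$ and all $p,q\in[1,\infty]$ with $\frac1p+\frac1q=1$, writing $r=\max(p,q)$ (and $\frac1\infty=\frac2\infty=0$), $$\frac{a_n}{\sqrt2\,(2n)!}\le\|T_n\|_{p,p}\le\frac{b_n^{2/r}}{(2n)!\,2^{1/r}} .$$ 4. Hence $\|T_n\|_{p,p}\asymp\frac1{(2n)!}$ uniformly in $p$: there are constants $c,C>0$ such that $\frac{c}{(2n)!}\le\|T_n\|_{p,p}\le\frac{C}{(2n)!}$ for all $n\ge1$ and $p\in[1,\infty]$. 5. For every $n\ge1$ and every $h\in\mathscr D(-1,1)$ (smooth, with compact support contained in $(-1,1)$) with $\int_{-1}^1|h|=1$, one has $\|h^{(2n)}\|_1\ge(2n)!$. -/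

import Mathlib

open MeasureTheory Set
open scoped ENNReal Nat

/-- `G` is a Green's function of the operator `(-1)^n d^{2n}/dt^{2n}` on `(-1,1)` with the boundary
conditions `ψ(±1) = ψ'(±1) = ⋯ = ψ^{(n-1)}(±1) = 0` (for `1 ≤ n`): for every source point
`s ∈ (-1,1)` the function `G(·,s)` is `C^{2n-2}` on `[-1,1]`, is smooth and solves the homogeneous
equation on either side of `s`, satisfies the boundary conditions, and its derivative of order
`2n-1` jumps by `(-1)^n` at `s`. -/
structure IsGreenFunction (n : ℕ) (G : ℝ → ℝ → ℝ) : Prop where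
  contDiffOn : ∀ s ∈ Ioo (-1 : ℝ) 1,
    ContDiffOn ℝ ((2 * n - 2 : ℕ) : ℕ∞) (fun t => G t s) (Icc (-1) 1)
  contDiffOn_left : ∀ s ∈ Ioo (-1 : ℝ) 1,
    ContDiffOn ℝ (⊤ : ℕ∞) (fun t => G t s) (Icc (-1) s)
  contDiffOn_right : ∀ s ∈ Ioo (-1 : ℝ) 1,
    ContDiffOn ℝ (⊤ : ℕ∞) (fun t => G t s) (Icc s 1)
  eqn_left : ∀ s ∈ Ioo (-1 : ℝ) 1, ∀ t ∈ Icc (-1) s,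
    (-1 : ℝ) ^ n * iteratedDerivWithin (2 * n) (fun t => G t s) (Icc (-1) s) t = 0
  eqn_right : ∀ s ∈ Ioo (-1 : ℝ) 1, ∀ t ∈ Icc s 1,
    (-1 : ℝ) ^ n * iteratedDerivWithin (2 * n) (fun t => G t s) (Icc s 1) t = 0
  bdry_left : ∀ s ∈ Ioo (-1 : ℝ) 1, ∀ j < n,
    iteratedDerivWithin j (fun t => G t s) (Icc (-1) s) (-1) = 0
  bdry_right : ∀ s ∈ Ioo (-1 : ℝ) 1, ∀ j < n,
    iteratedDerivWithin j (fun t => G t s) (Icc s 1) 1 = 0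
  jump : ∀ s ∈ Ioo (-1 : ℝ) 1,
    iteratedDerivWithin (2 * n - 1) (fun t => G t s) (Icc s 1) s
      - iteratedDerivWithin (2 * n - 1) (fun t => G t s) (Icc (-1) s) s = (-1) ^ n

theorem contDiff_max_zero_pow (m : ℕ) :
    ContDiff ℝ (m : ℕ∞) (fun x : ℝ => (max x 0) ^ (m + 1)) := by
  have hd : ∀ (k : ℕ) (x : ℝ), HasDerivAt (fun x : ℝ => (max x 0) ^ (k + 2))
      ((k + 2 : ℝ) * (max x 0) ^ (k + 1)) x := by
    intro k x
    rcases lt_trichotomy x 0 with h | h | h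
    · have : HasDerivAt (fun _ : ℝ => (0 : ℝ)) 0 x := hasDerivAt_const x 0
      rw [max_eq_right h.le]
      simp only [ne_eq, Nat.add_eq_zero_iff, one_ne_zero, and_false, not_false_eq_true, zero_pow,
        mul_zero]
      refine this.congr_of_eventuallyEq ?_
      filter_upwards [Iio_mem_nhds h] with y hy
      rw [max_eq_right (le_of_lt hy)]; simp
    · subst h
      simp only [max_self, ne_eq, Nat.add_eq_zero_iff, one_ne_zero, and_false, not_false_eq_true,
        zero_pow, mul_zero]
      rw [hasDerivAt_iff_isLittleO]
      simp only [max_self, sub_zero, smul_zero]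
      have h1 : (fun x : ℝ => (max x 0) ^ (k + 2) - 0 ^ (k + 2)) =O[nhds 0]
          (fun x : ℝ => x ^ (k + 2)) := by
        refine Asymptotics.IsBigO.of_bound 1 (Filter.Eventually.of_forall fun y => ?_)
        simp only [ne_eq, Nat.add_eq_zero_iff, OfNat.ofNat_ne_zero, and_false, not_false_eq_true,
          zero_pow, sub_zero, norm_pow, Real.norm_eq_abs, one_mul]
        refine pow_le_pow_left₀ (abs_nonneg _) ?_ _
        rw [abs_of_nonneg (le_max_right y 0)]
        exact max_le (le_abs_self y) (abs_nonneg y)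
      exact h1.trans_isLittleO (Asymptotics.isLittleO_pow_id (by omega))
    · have := hasDerivAt_pow (k + 2) x
      rw [max_eq_left h.le]
      have h2 : HasDerivAt (fun x : ℝ => x ^ (k + 2)) ((k + 2 : ℝ) * x ^ (k + 1)) x := by
        simpa using this
      refine h2.congr_of_eventuallyEq ?_
      filter_upwards [Ioi_mem_nhds h] with y hy
      rw [max_eq_left (le_of_lt hy)]
  induction m with
  | zero => simp only [Nat.cast_zero, zero_add, pow_one]; exact contDiff_zero.2 (by fun_prop)
  | succ k ih =>
    have : (((k + 1 : ℕ) : ℕ∞) : WithTop ℕ∞) = ((k : ℕ∞) : WithTop ℕ∞) + 1 := by push_cast; rfl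
    rw [this, contDiff_succ_iff_deriv]
    refine ⟨fun x => (hd k x).differentiableAt, by simp, ?_⟩
    have h3 : deriv (fun x : ℝ => (max x 0) ^ (k + 1 + 1))
        = fun x => (k + 2 : ℝ) * (max x 0) ^ (k + 1) := funext fun x => (hd k x).deriv
    rw [h3]
    exact contDiff_const.mul ih

theorem contDiff_polynomial_eval {m : WithTop ℕ∞} (P : Polynomial ℝ) :
    ContDiff ℝ m (fun x : ℝ => P.eval x) := by
  have := P.contDiff_aeval (𝕜 := ℝ) (R := ℝ) m
  simpa using this

theorem iteratedDerivWithin_polynomial (P : Polynomial ℝ) {a b : ℝ} (hab : a < b) (k : ℕ) {t : ℝ}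
    (ht : t ∈ Icc a b) {g : ℝ → ℝ} (hg : ∀ x ∈ Icc a b, g x = P.eval x) :
    iteratedDerivWithin k g (Icc a b) t = (Polynomial.derivative^[k] P).eval t := by
  rw [iteratedDerivWithin_congr (g := fun x => P.eval x) (fun x hx => hg x hx) ht,
    iteratedDerivWithin_eq_iteratedDeriv (uniqueDiffOn_Icc hab) (contDiff_polynomial_eval P).contDiffAt ht]
  rw [iteratedDeriv_eq_iterate]
  have : ∀ (k : ℕ) (Q : Polynomial ℝ), deriv^[k] (fun x => Q.eval x)
      = fun x => (Polynomial.derivative^[k] Q).eval x := by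
    intro k
    induction k with
    | zero => intro Q; rfl
    | succ k ih =>
      intro Q
      rw [Function.iterate_succ_apply, Function.iterate_succ_apply, ← ih]
      congr 1
      funext x
      exact Q.deriv
  rw [this]

theorem exists_greenPolynomials (n : ℕ) (hn : 1 ≤ n) (s : ℝ) : ∃ L R : Polynomial ℝ,
    L.degree < (2 * n : ℕ) ∧ R.degree < (2 * n : ℕ) ∧
    (Polynomial.X - Polynomial.C (-1)) ^ n ∣ L ∧ (Polynomial.X - Polynomial.C 1) ^ n ∣ R ∧
    R = L + Polynomial.C ((-1) ^ n / ((2 * n - 1)! : ℝ))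
      * (Polynomial.X - Polynomial.C s) ^ (2 * n - 1) := by
  open Polynomial in
  set c : ℝ := (-1) ^ n / ((2 * n - 1)! : ℝ)
  set F : ℝ[X] := C c * (X - C s) ^ (2 * n - 1)
  have hFd : F.degree < (2 * n : ℕ) := by
    refine lt_of_le_of_lt (degree_mul_le _ _) (lt_of_le_of_lt (add_le_add_left degree_C_le _) ?_)
    rw [zero_add, degree_pow, degree_X_sub_C]
    simp only [nsmul_eq_mul, mul_one]
    exact_mod_cast (by omega : 2 * n - 1 < 2 * n)
  have hcop : IsCoprime ((X - C (-1 : ℝ)) ^ n) ((X - C (1 : ℝ)) ^ n) :=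
    (isCoprime_X_sub_C_of_isUnit_sub (by norm_num)).pow
  obtain ⟨u, v, huv⟩ := hcop
  set p : ℝ[X] := (X - C (-1 : ℝ)) ^ n with hp
  set q : ℝ[X] := (X - C (1 : ℝ)) ^ n with hq
  have hpm : p.Monic := (monic_X_sub_C _).pow n
  have hqm : q.Monic := (monic_X_sub_C _).pow n
  have hpd : p.degree = n := by rw [hp, degree_pow, degree_X_sub_C]; simp
  have hqd : q.degree = n := by rw [hq, degree_pow, degree_X_sub_C]; simp
  set A : ℝ[X] := (F * v) %ₘ p
  have hA : A + p * ((F * v) /ₘ p) = F * v := modByMonic_add_div _ p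
  have hAd : A.degree < n := hpd ▸ degree_modByMonic_lt _ hpm
  have hRd : (A * q).degree < (2 * n : ℕ) := by
    rw [degree_mul, hqd]
    have h2 : ((2 * n : ℕ) : WithBot ℕ) = (n : WithBot ℕ) + (n : WithBot ℕ) := by
      rw [two_mul]; push_cast; rfl
    rw [h2]
    exact WithBot.add_lt_add_right (WithBot.coe_ne_bot) hAd
  refine ⟨A * q - F, A * q, ?_, hRd, ?_, dvd_mul_left _ _, by ring⟩
  · exact lt_of_le_of_lt (degree_sub_le _ _) (max_lt hRd hFd)
  · refine ⟨-(((F * v) /ₘ p) * q) - F * u, ?_⟩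
    linear_combination q * hA + F * huv

theorem exists_isGreenFunction (n : ℕ) (hn : 1 ≤ n) : ∃ G, IsGreenFunction n G := by
  choose L R hL hR hpL hpR hLR using exists_greenPolynomials n hn
  set G : ℝ → ℝ → ℝ := fun t s => if t ≤ s then (L s).eval t else (R s).eval t with hG
  have hGl : ∀ s a, ∀ t ∈ Icc a s, G t s = (L s).eval t := fun s a t ht => by
    simp [hG, ht.2]
  have hGr : ∀ s b, ∀ t ∈ Icc s b, G t s = (R s).eval t := fun s b t ht => by
    rcases ht.1.eq_or_lt with h | h
    · subst h
      have : 2 * n - 1 ≠ 0 := by omega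
      simp [hG, hLR, this]
    · simp [hG, not_le.2 h]
  have hz : ∀ (P : Polynomial ℝ), P.degree < (2 * n : ℕ) →
      Polynomial.derivative^[2 * n] P = 0 := fun P hP =>
    Polynomial.iterate_derivative_eq_zero_of_degree_lt hP
  have hb : ∀ (P : Polynomial ℝ) (x : ℝ), (Polynomial.X - Polynomial.C x) ^ n ∣ P →
      ∀ j < n, (Polynomial.derivative^[j] P).eval x = 0 := by
    intro P x hP j hj
    have h1 := Polynomial.pow_sub_dvd_iterate_derivative_of_pow_dvd j hP
    exact Polynomial.dvd_iff_isRoot.1 ((dvd_pow_self _ (by omega)).trans h1)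
  refine ⟨G, ?_, ?_, ?_, ?_, ?_, ?_, ?_, ?_⟩
  · intro s hs
    have h1 : (fun t => G t s) = fun t => (L s).eval t
        + ((-1) ^ n / ((2 * n - 1)! : ℝ)) * (max (t - s) 0) ^ (2 * n - 2 + 1) := by
      have h21 : 2 * n - 2 + 1 = 2 * n - 1 := by omega
      have h0 : 2 * n - 1 ≠ 0 := by omega
      funext t
      rw [h21]
      by_cases h : t ≤ s
      · simp [hG, h, h0]
      · simp [hG, h, hLR, max_eq_left (sub_nonneg.2 (le_of_not_ge h))]
    rw [h1]
    refine ContDiff.contDiffOn ((contDiff_polynomial_eval (L s)).add (contDiff_const.mul ?_))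
    exact (contDiff_max_zero_pow (2 * n - 2)).comp (contDiff_id.sub contDiff_const)
  · intro s hs
    exact ((contDiff_polynomial_eval (L s)).contDiffOn).congr (hGl s (-1))
  · intro s hs
    exact ((contDiff_polynomial_eval (R s)).contDiffOn).congr (hGr s 1)
  · intro s hs t ht
    rw [iteratedDerivWithin_polynomial (L s) hs.1 _ ht (hGl s (-1)), hz _ (hL s)]; simp
  · intro s hs t ht
    rw [iteratedDerivWithin_polynomial (R s) hs.2 _ ht (hGr s 1), hz _ (hR s)]; simp
  · intro s hs j hj
    rw [iteratedDerivWithin_polynomial (L s) hs.1 _ (left_mem_Icc.2 hs.1.le) (hGl s (-1))]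
    exact hb _ _ (hpL s) j hj
  · intro s hs j hj
    rw [iteratedDerivWithin_polynomial (R s) hs.2 _ (right_mem_Icc.2 hs.2.le) (hGr s 1)]
    exact hb _ _ (hpR s) j hj
  · intro s hs
    rw [iteratedDerivWithin_polynomial (R s) hs.2 _ (left_mem_Icc.2 hs.2.le) (hGr s 1),
      iteratedDerivWithin_polynomial (L s) hs.1 _ (right_mem_Icc.2 hs.1.le) (hGl s (-1)), hLR s,
      iterate_map_add, Polynomial.eval_add, add_sub_cancel_left,
      Polynomial.iterate_derivative_C_mul, Polynomial.iterate_derivative_X_sub_pow_self]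
    have : ((2 * n - 1)! : ℝ) ≠ 0 := by positivity
    simp [this]

/-- The Green's function `G_n` (for `1 ≤ n`; its existence is `exists_isGreenFunction`, and the
defining conditions determine it on `[-1,1] × (-1,1)`). -/
noncomputable def greenFunction (n : ℕ) : ℝ → ℝ → ℝ :=
  Classical.epsilon (IsGreenFunction n)

theorem isGreenFunction_greenFunction (n : ℕ) (hn : 1 ≤ n) :
    IsGreenFunction n (greenFunction n) :=
  Classical.epsilon_spec (exists_isGreenFunction n hn)

/-- Lebesgue measure on the interval `(-1,1)`. -/
noncomputable def intervalMeasure : Measure ℝ := volume.restrict (Ioo (-1) 1)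

/-- The solution operator `(T_n f)(t) = ∫_{-1}^1 G_n(t,s) f(s) ds`. -/
noncomputable def solutionOperator {𝕜 : Type*} [RCLike 𝕜] (n : ℕ) (f : ℝ → 𝕜) : ℝ → 𝕜 :=
  fun t => ∫ s, (greenFunction n t s : 𝕜) * f s ∂intervalMeasure

/-- The operator norm `‖T_n‖_{p,p}` of `T_n` acting on `L^p(-1,1)` (with values in `𝕜`), as the
supremum of `‖T_n f‖_p` over the closed unit ball of `L^p(-1,1)`. -/
noncomputable def solutionOpNorm (𝕜 : Type*) [RCLike 𝕜] (n : ℕ) (p : ℝ≥0∞) : ℝ≥0∞ :=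
  ⨆ (f : ℝ → 𝕜) (_ : MemLp f p intervalMeasure) (_ : eLpNorm f p intervalMeasure ≤ 1),
    eLpNorm (solutionOperator n f) p intervalMeasure

/-- `a_n = √2 (2n)! α_n`, where `α_n = Γ(n+1/2) / (2 Γ(n+1) Γ(2n+1/2))`. -/
noncomputable def lowerFactor (n : ℕ) : ℝ :=
  √2 * (2 * n)! * (Real.Gamma (n + 1 / 2) / (2 * Real.Gamma (n + 1) * Real.Gamma (2 * n + 1 / 2)))

/-- `R_n = ₃F₂(1/2, 1, -n; 1-2n, n+1; 1)`, a series that terminates at `k = n`. -/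
noncomputable def hypergeometricRatio (n : ℕ) : ℝ :=
  ∑ k ∈ Finset.range (n + 1),
    (ascPochhammer ℝ k).eval (1 / 2) * (ascPochhammer ℝ k).eval 1 *
        (ascPochhammer ℝ k).eval (-n : ℝ) /
      ((ascPochhammer ℝ k).eval (1 - 2 * n : ℝ) * (ascPochhammer ℝ k).eval (n + 1 : ℝ) * k !)

/-- `b_n = R_n a_n`. -/
noncomputable def upperFactor (n : ℕ) : ℝ :=
  hypergeometricRatio n * lowerFactor n

/-- `h ∈ 𝒟(-1,1)`: smooth with compact support contained in the open interval `(-1,1)`. -/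
def IsTestFunction {𝕜 : Type*} [RCLike 𝕜] (h : ℝ → 𝕜) : Prop :=
  ContDiff ℝ (⊤ : ℕ∞) h ∧ HasCompactSupport h ∧ tsupport h ⊆ Ioo (-1) 1

/-! The conditions on G_n(·,s) say that it consists of two polynomials of degree < 2n, divisible by
(X+1)^n and (X-1)^n, whose difference is a fixed multiple of (X-s)^(2n-1). Coprimality makes such a
pair unique (`IsGreenPair.unique`), and Boggio's explicit kernel provides one
(`isGreenPair_boggio`). Hence G_n is symmetric and nonnegative, and integration by parts shows that
T_n inverts (-1)^n d^(2n)/dt^(2n) on smooth functions vanishing to order n at ±1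
(`integral_boggioKernel_mul_iteratedDeriv`).

Everything else comes from two exact evaluations, with w(t) = (1-t²)^n. First, T_n 1 = w/(2n)!,
whose supremum is 1/(2n)!. With symmetry this gives the norms on L^∞ and L^1, and Schur's test with
constant weight bounds every p by the same number. Second, T_n w = α_n Σ c_k (1-t²)^(n+k), where the
c_k are the positive terms of R_n and c_0 = 1. Comparing coefficients reduces this to the
Chu–Vandermonde identity (`sum_hypergeometricTerm_mul_choose`). Consequently α_n w ≤ T_n w ≤ R_n α_n
w.

The left inequality makes w a test function giving ‖T_n‖ ≥ α_n for all p. For the upper bound,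
Hölder interpolates between T_n 1 ≤ 1/(2n)! and T_n w ≤ R_n α_n w, and Schur's test with weight
w^(1/r) yields (R_n α_n)^(2/r) ((2n)!)^(2/r-1), which is the stated bound. The limit of a_n follows
from log-convexity of Γ, that of R_n from geometric decay of the c_k. The inequality for test
functions is the L^1 bound applied to h = T_n((-1)^n h^(2n)). -/

/-! ### Green's functions as pairs of polynomials -/

open Polynomial in
/-- A function on `[a,b]` whose `m`-th derivative vanishes is a polynomial of degree `< m`. -/
theorem exists_polynomial_of_iteratedDerivWithin_eq_zero {f : ℝ → ℝ} {a b : ℝ} (hab : a < b)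
    {m : ℕ} (hm : 1 ≤ m) (hf : ContDiffOn ℝ (⊤ : ℕ∞) f (Icc a b))
    (h0 : ∀ t ∈ Icc a b, iteratedDerivWithin m f (Icc a b) t = 0) :
    ∃ P : ℝ[X], P.degree < m ∧ ∀ t ∈ Icc a b, f t = P.eval t := by
  obtain ⟨m, rfl⟩ : ∃ k, m = k + 1 := ⟨m - 1, by omega⟩
  refine ⟨∑ k ∈ Finset.range (m + 1),
    C ((k ! : ℝ)⁻¹ * iteratedDerivWithin k f (Icc a b) a) * (X - C a) ^ k, ?_, ?_⟩
  · rw [← mem_degreeLT]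
    refine Submodule.sum_mem _ fun k hk => mem_degreeLT.2 ?_
    refine lt_of_le_of_lt (degree_mul_le _ _) (lt_of_le_of_lt (add_le_add_left degree_C_le _) ?_)
    rw [zero_add, degree_pow, degree_X_sub_C]
    simp only [nsmul_eq_mul, mul_one]
    exact_mod_cast Finset.mem_range.1 hk
  · intro t ht
    -- The bound 0 on the derivative of order `m + 1` kills the Taylor remainder, so `f` equals its
    -- Taylor polynomial at `a`.
    have h1 := taylor_mean_remainder_bound (n := m) (C := 0) hab.le
      (hf.of_le (by exact_mod_cast le_top)) ht (fun y hy => by rw [h0 y hy]; simp)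
    rw [zero_mul, zero_div, norm_le_zero_iff, sub_eq_zero] at h1
    rw [h1, taylor_within_apply, eval_finsetSum]
    refine Finset.sum_congr rfl fun k _ => ?_
    simp only [smul_eq_mul, eval_mul, eval_C, eval_pow, eval_sub, eval_X]
    ring

open Polynomial in
theorem X_sub_C_pow_dvd_of_iterate_derivative {P : ℝ[X]} {x : ℝ} {n : ℕ}
    (h : ∀ j < n, (derivative^[j] P).eval x = 0) : (X - C x) ^ n ∣ P := by
  rcases eq_or_ne P 0 with rfl | hP
  · exact dvd_zero _
  rcases n with _ | n
  · simp
  have := lt_rootMultiplicity_of_isRoot_iterate_derivative (n := n) hP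
    (fun m hm => h m (by omega))
  exact (pow_dvd_pow _ this).trans (P.pow_rootMultiplicity_dvd x)

open Polynomial in
theorem iterate_derivative_eval_eq_zero_of_dvd {P : ℝ[X]} {x : ℝ} {n j : ℕ}
    (h : (X - C x) ^ n ∣ P) (hj : j < n) : (derivative^[j] P).eval x = 0 :=
  dvd_iff_isRoot.1 ((dvd_pow_self _ (by omega)).trans
    (pow_sub_dvd_iterate_derivative_of_pow_dvd j h))

-- After subtracting the candidate, all derivatives of order ≤ m vanish at x, so the difference is
-- divisible by a power exceeding its degree. With m = 2n-1 this turns C^(2n-2) matching plus the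
-- jump condition into a polynomial identity.
open Polynomial in
theorem eq_C_mul_X_sub_C_pow_of_degree {P : ℝ[X]} {x c : ℝ} {m : ℕ} (hd : P.degree < (m + 1 : ℕ))
    (h : ∀ j < m, (derivative^[j] P).eval x = 0) (hc : (derivative^[m] P).eval x = c) :
    P = C (c / (m ! : ℝ)) * (X - C x) ^ m := by
  have hm : (m ! : ℝ) ≠ 0 := by positivity
  have h1 : (X - C x) ^ (m + 1) ∣ P - C (c / (m ! : ℝ)) * (X - C x) ^ m := by
    refine X_sub_C_pow_dvd_of_iterate_derivative fun j hj => ?_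
    rw [iterate_derivative_sub, eval_sub]
    rcases Nat.lt_succ_iff_lt_or_eq.1 hj with hj | rfl
    · rw [h j hj, iterate_derivative_eval_eq_zero_of_dvd (dvd_mul_left _ _) hj, sub_zero]
    · rw [hc, iterate_derivative_C_mul, iterate_derivative_X_sub_pow_self]
      simp [hm]
  refine sub_eq_zero.1 (eq_zero_of_dvd_of_degree_lt h1 ?_)
  rw [degree_pow, degree_X_sub_C]
  simp only [nsmul_eq_mul, mul_one]
  refine lt_of_le_of_lt (degree_sub_le _ _) (max_lt (by exact_mod_cast hd) ?_)
  refine lt_of_le_of_lt (degree_mul_le _ _) (lt_of_le_of_lt (add_le_add_left degree_C_le _) ?_)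
  rw [zero_add, degree_pow, degree_X_sub_C]
  simp only [nsmul_eq_mul, mul_one]
  exact_mod_cast m.lt_succ_self

theorem iteratedDerivWithin_Icc_subset {f : ℝ → ℝ} {a b c d x : ℝ} {k : ℕ} (hab : a < b)
    (hcd : c < d) (hsub : Icc a b ⊆ Icc c d) (hf : ContDiffOn ℝ k f (Icc c d))
    (hx : x ∈ Icc a b) :
    iteratedDerivWithin k f (Icc a b) x = iteratedDerivWithin k f (Icc c d) x := by
  simp only [iteratedDerivWithin]
  rw [iteratedFDerivWithin_subset hsub (uniqueDiffOn_Icc hab) (uniqueDiffOn_Icc hcd) hf hx]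

/-- The pair of polynomials that make up a Green's function with source point `s`. -/
structure IsGreenPair (n : ℕ) (s : ℝ) (L R : Polynomial ℝ) : Prop where
  degree_left : L.degree < (2 * n : ℕ)
  degree_right : R.degree < (2 * n : ℕ)
  dvd_left : (Polynomial.X - Polynomial.C (-1)) ^ n ∣ L
  dvd_right : (Polynomial.X - Polynomial.C 1) ^ n ∣ R
  jump : R - L = Polynomial.C ((-1) ^ n / ((2 * n - 1)! : ℝ))
    * (Polynomial.X - Polynomial.C s) ^ (2 * n - 1)

-- The common jump forces R - R' = L - L', so one polynomial of degree < 2n is divisible by both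
-- coprime factors (X+1)^n and (X-1)^n.
open Polynomial in
theorem IsGreenPair.unique {n : ℕ} {s : ℝ} {L R L' R' : ℝ[X]} (h : IsGreenPair n s L R)
    (h' : IsGreenPair n s L' R') : L = L' ∧ R = R' := by
  have hLR : R - R' = L - L' := by linear_combination h.jump - h'.jump
  have h1 : (X - C (-1 : ℝ)) ^ n ∣ L - L' := dvd_sub h.dvd_left h'.dvd_left
  have h2 : (X - C (1 : ℝ)) ^ n ∣ L - L' := hLR ▸ dvd_sub h.dvd_right h'.dvd_right
  have hcop : IsCoprime ((X - C (-1 : ℝ)) ^ n) ((X - C (1 : ℝ)) ^ n) :=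
    (isCoprime_X_sub_C_of_isUnit_sub (by norm_num)).pow
  have h3 := hcop.mul_dvd h1 h2
  have h4 : L - L' = 0 := by
    refine eq_zero_of_dvd_of_degree_lt h3 ?_
    refine lt_of_lt_of_eq
      (lt_of_le_of_lt (degree_sub_le _ _) (max_lt h.degree_left h'.degree_left)) ?_
    rw [degree_mul, degree_pow, degree_pow, degree_X_sub_C, degree_X_sub_C, two_mul]
    simp
  exact ⟨sub_eq_zero.1 h4, sub_eq_zero.1 (hLR.trans h4)⟩

open Polynomial in
theorem IsGreenFunction.exists_isGreenPair {n : ℕ} (hn : 1 ≤ n) {G : ℝ → ℝ → ℝ}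
    (hG : IsGreenFunction n G) {s : ℝ} (hs : s ∈ Ioo (-1 : ℝ) 1) :
    ∃ L R : ℝ[X], IsGreenPair n s L R ∧ (∀ t ∈ Icc (-1) s, G t s = L.eval t) ∧
      ∀ t ∈ Icc s 1, G t s = R.eval t := by
  have hne : ((-1 : ℝ) ^ n) ≠ 0 := by positivity
  obtain ⟨L, hLd, hL⟩ := exists_polynomial_of_iteratedDerivWithin_eq_zero (m := 2 * n) hs.1
    (by omega) (hG.contDiffOn_left s hs)
    (fun t ht => (mul_eq_zero.1 (hG.eqn_left s hs t ht)).resolve_left hne)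
  obtain ⟨R, hRd, hR⟩ := exists_polynomial_of_iteratedDerivWithin_eq_zero (m := 2 * n) hs.2
    (by omega) (hG.contDiffOn_right s hs)
    (fun t ht => (mul_eq_zero.1 (hG.eqn_right s hs t ht)).resolve_left hne)
  have hsl : s ∈ Icc (-1) s := right_mem_Icc.2 hs.1.le
  have hsr : s ∈ Icc s 1 := left_mem_Icc.2 hs.2.le
  refine ⟨L, R, ⟨hLd, hRd, ?_, ?_, ?_⟩, hL, hR⟩
  · refine X_sub_C_pow_dvd_of_iterate_derivative fun j hj => ?_
    rw [← iteratedDerivWithin_polynomial L hs.1 j (left_mem_Icc.2 hs.1.le) hL]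
    exact hG.bdry_left s hs j hj
  · refine X_sub_C_pow_dvd_of_iterate_derivative fun j hj => ?_
    rw [← iteratedDerivWithin_polynomial R hs.2 j (right_mem_Icc.2 hs.2.le) hR]
    exact hG.bdry_right s hs j hj
  · refine eq_C_mul_X_sub_C_pow_of_degree ?_ ?_ ?_
    · rw [show 2 * n - 1 + 1 = 2 * n by omega]
      exact lt_of_le_of_lt (degree_sub_le _ _) (max_lt hRd hLd)
    · intro j hj
      -- Below order 2n-1 both one-sided derivatives at s agree with the derivative on the whole
      -- interval, hence with each other.
      have hc : ContDiffOn ℝ j (fun t => G t s) (Icc (-1) 1) :=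
        (hG.contDiffOn s hs).of_le (by exact_mod_cast (by omega : j ≤ 2 * n - 2))
      rw [iterate_derivative_sub, eval_sub,
        ← iteratedDerivWithin_polynomial L hs.1 j hsl hL,
        ← iteratedDerivWithin_polynomial R hs.2 j hsr hR,
        iteratedDerivWithin_Icc_subset hs.1 (by norm_num) (Icc_subset_Icc_right hs.2.le) hc hsl,
        iteratedDerivWithin_Icc_subset hs.2 (by norm_num) (Icc_subset_Icc_left hs.1.le) hc hsr,
        sub_self]
    · rw [iterate_derivative_sub, eval_sub,
        ← iteratedDerivWithin_polynomial L hs.1 _ hsl hL,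
        ← iteratedDerivWithin_polynomial R hs.2 _ hsr hR]
      exact hG.jump s hs

/-! ### Boggio's formula -/

/-- This is the Beta integral ∫₀¹ x^N (1-x)^m dx expanded binomially; the proof is by Pascal's rule.
-/
theorem sum_neg_one_pow_mul_choose_div (m N : ℕ) :
    ∑ j ∈ Finset.range (m + 1), (m.choose j : ℝ) * ((-1) ^ j / (N + 1 + j))
      = m ! * N ! / ((N + m + 1)! : ℝ) := by
  induction m generalizing N with
  | zero =>
    have h0 : (N ! : ℝ) ≠ 0 := by positivity
    simp only [zero_add, Finset.range_one, Finset.sum_singleton, Nat.choose_self, Nat.cast_one,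
      pow_zero, Nat.cast_zero, add_zero, Nat.factorial_zero, one_mul]
    rw [Nat.factorial_succ]
    push_cast
    field_simp
  | succ m ih =>
    have h1 := Finset.sum_choose_succ_mul (R := ℝ)
      (fun j _ => (-1) ^ j / ((N : ℝ) + 1 + j)) m
    have h2 : ∑ i ∈ Finset.range (m + 1), (m.choose i : ℝ) * ((-1) ^ (i + 1) / (N + 1 + (i + 1 : ℕ)))
        = -(m ! * (N + 1)! / ((N + 1 + m + 1)! : ℝ)) := by
      rw [← ih (N + 1), ← Finset.sum_neg_distrib]
      refine Finset.sum_congr rfl fun i _ => ?_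
      push_cast
      rw [pow_succ, show (N : ℝ) + 1 + (i + 1) = N + 1 + 1 + i by ring]
      ring
    rw [show m + 1 + 1 = m + 2 by ring]
    refine h1.trans ?_
    rw [ih N, h2]
    have h0 : ((N + m + 1)! : ℝ) ≠ 0 := by positivity
    rw [show N + (m + 1) + 1 = (N + m + 1) + 1 by ring,
      show N + 1 + m + 1 = (N + m + 1) + 1 by ring,
      Nat.factorial_succ (N + m + 1), Nat.factorial_succ N, Nat.factorial_succ m]
    push_cast
    field_simp
    ring

/-- The integral `(2^{2n-1} (n-1)!²)⁻¹ ∫_0^a y^{n-1} (y + 2d)^{n-1} dy`, as an explicit sum. -/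
noncomputable def boggioPrimitive (n : ℕ) (a d : ℝ) : ℝ :=
  (2 ^ (2 * n - 1) * ((n - 1)! : ℝ) ^ 2)⁻¹ *
    ∑ j ∈ Finset.range n, ((n - 1).choose j : ℝ) * a ^ (n + j) * (2 * d) ^ (n - 1 - j) / (n + j)

theorem hasDerivAt_boggioPrimitive {n : ℕ} (hn : 1 ≤ n) (a d : ℝ) :
    HasDerivAt (fun x => boggioPrimitive n x d)
      ((2 ^ (2 * n - 1) * ((n - 1)! : ℝ) ^ 2)⁻¹ * (a * (a + 2 * d)) ^ (n - 1)) a := by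
  obtain ⟨m, rfl⟩ : ∃ m, n = m + 1 := ⟨n - 1, by omega⟩
  unfold boggioPrimitive
  refine HasDerivAt.const_mul _ ?_
  simp only [add_tsub_cancel_right]
  have h : (a * (a + 2 * d)) ^ m = ∑ j ∈ Finset.range (m + 1),
      (m.choose j : ℝ) * (((m + 1 + j : ℕ) : ℝ) * a ^ (m + 1 + j - 1)) * (2 * d) ^ (m - j)
        / ((m + 1 : ℕ) + j) := by
    rw [mul_pow, add_pow, Finset.mul_sum]
    refine Finset.sum_congr rfl fun j _ => ?_
    have : ((m + 1 : ℕ) : ℝ) + j ≠ 0 := by positivity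
    rw [show m + 1 + j - 1 = m + j by omega, pow_add]
    push_cast at this ⊢
    field_simp
  rw [h]
  refine HasDerivAt.fun_sum fun j _ => ?_
  exact (((hasDerivAt_pow (m + 1 + j) a).const_mul _).mul_const _).div_const _

theorem boggioPrimitive_zero {n : ℕ} (hn : 1 ≤ n) (d : ℝ) : boggioPrimitive n 0 d = 0 := by
  have : ∀ j, (0 : ℝ) ^ (n + j) = 0 := fun j => zero_pow (by omega)
  simp [boggioPrimitive, this]

/-- The underlying integral of (y(y-2d))^(n-1) over [0,2d] is a Beta integral; its value explains
the normalising constant in `boggioPrimitive`. -/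
theorem boggioPrimitive_two_mul_neg {n : ℕ} (hn : 1 ≤ n) (d : ℝ) :
    boggioPrimitive n (2 * d) (-d) = -((-1) ^ n / ((2 * n - 1)! : ℝ) * d ^ (2 * n - 1)) := by
  obtain ⟨m, rfl⟩ : ∃ m, n = m + 1 := ⟨n - 1, by omega⟩
  unfold boggioPrimitive
  simp only [add_tsub_cancel_right]
  have h : ∑ j ∈ Finset.range (m + 1),
      (m.choose j : ℝ) * (2 * d) ^ (m + 1 + j) * (2 * -d) ^ (m - j) / ((m + 1 : ℕ) + j)
      = (-1) ^ m * (2 * d) ^ (2 * m + 1) * (m ! * m ! / ((m + m + 1)! : ℝ)) := by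
    rw [← sum_neg_one_pow_mul_choose_div, Finset.mul_sum]
    refine Finset.sum_congr rfl fun j hj => ?_
    have hj' : j ≤ m := Nat.lt_succ_iff.1 (Finset.mem_range.1 hj)
    have h1 : (2 * -d) ^ (m - j) = (-1) ^ m * (-1) ^ j * (2 * d) ^ (m - j) := by
      rw [show 2 * -d = (-1) * (2 * d) by ring, mul_pow, ← pow_add]
      congr 1
      rw [show m + j = (m - j) + 2 * j by omega, pow_add, pow_mul]
      simp
    rw [h1, show (2 * d) ^ (2 * m + 1) = (2 * d) ^ (m + 1 + j) * (2 * d) ^ (m - j) by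
      rw [← pow_add]; congr 1; omega]
    push_cast
    ring
  rw [h, show 2 * (m + 1) - 1 = 2 * m + 1 by omega, show m + m + 1 = 2 * m + 1 by ring]
  have h1 : (m ! : ℝ) ≠ 0 := by positivity
  have h2 : ((2 * m + 1)! : ℝ) ≠ 0 := by positivity
  rw [mul_pow, pow_succ (-1 : ℝ) m]
  field_simp

/-- Shifting y by ±d turns both integrands into (z²-d²)^(n-1) with the same upper limit c, so the
difference does not depend on c and can be evaluated at c = d. -/
theorem boggioPrimitive_sub_boggioPrimitive {n : ℕ} (hn : 1 ≤ n) (c d : ℝ) :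
    boggioPrimitive n (c - d) d - boggioPrimitive n (c + d) (-d)
      = (-1) ^ n / ((2 * n - 1)! : ℝ) * d ^ (2 * n - 1) := by
  have hder : ∀ c : ℝ, HasDerivAt
      (fun c => boggioPrimitive n (c - d) d - boggioPrimitive n (c + d) (-d)) 0 c := by
    intro c
    have h1 := (hasDerivAt_boggioPrimitive hn (c - d) d).comp_sub_const c d
    have h2 := (hasDerivAt_boggioPrimitive hn (c + d) (-d)).comp_add_const c d
    refine (h1.sub h2).congr_deriv ?_
    rw [show (c - d) * (c - d + 2 * d) = (c + d) * (c + d + 2 * -d) by ring, sub_self]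
  have hconst := is_const_of_deriv_eq_zero (fun c => (hder c).differentiableAt)
    (fun c => (hder c).deriv) c d
  rw [hconst, sub_self, boggioPrimitive_zero hn, ← two_mul, boggioPrimitive_two_mul_neg hn]
  ring

/-- The explicit Green's function (Boggio's formula). -/
noncomputable def boggioKernel (n : ℕ) (t s : ℝ) : ℝ :=
  boggioPrimitive n ((1 - max t s) * (1 + min t s)) |t - s|

theorem boggioKernel_comm (n : ℕ) (t s : ℝ) : boggioKernel n t s = boggioKernel n s t := by
  rw [boggioKernel, boggioKernel, max_comm, min_comm, abs_sub_comm]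

theorem boggioPrimitive_nonneg (n : ℕ) {a d : ℝ} (ha : 0 ≤ a) (hd : 0 ≤ d) :
    0 ≤ boggioPrimitive n a d := by
  unfold boggioPrimitive
  positivity

theorem boggioKernel_nonneg (n : ℕ) {t s : ℝ} (ht : t ∈ Ioo (-1 : ℝ) 1) (hs : s ∈ Ioo (-1 : ℝ) 1) :
    0 ≤ boggioKernel n t s := by
  refine boggioPrimitive_nonneg n (mul_nonneg ?_ ?_) (abs_nonneg _)
  · linarith [max_lt ht.2 hs.2]
  · linarith [lt_min ht.1 hs.1]

theorem continuous_boggioKernel (n : ℕ) :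
    Continuous (fun z : ℝ × ℝ => boggioKernel n z.1 z.2) := by
  unfold boggioKernel boggioPrimitive
  refine continuous_const.mul (continuous_finsetSum _ fun j _ => ?_)
  fun_prop

open Polynomial in
/-- The polynomial `t ↦ boggioPrimitive n (A t) (D t)`. -/
noncomputable def boggioPolynomial (n : ℕ) (A D : ℝ[X]) : ℝ[X] :=
  C ((2 ^ (2 * n - 1) * ((n - 1)! : ℝ) ^ 2)⁻¹) *
    ∑ j ∈ Finset.range n, C (((n - 1).choose j : ℝ) / (n + j)) * (A ^ (n + j) * (2 * D) ^ (n - 1 - j))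

open Polynomial in
theorem eval_boggioPolynomial (n : ℕ) (A D : ℝ[X]) (t : ℝ) :
    (boggioPolynomial n A D).eval t = boggioPrimitive n (A.eval t) (D.eval t) := by
  simp only [boggioPolynomial, boggioPrimitive, eval_mul, eval_C, eval_finsetSum, eval_pow,
    eval_ofNat]
  congr 1
  refine Finset.sum_congr rfl fun j _ => ?_
  ring

open Polynomial in
theorem pow_dvd_boggioPolynomial (n : ℕ) {A D P : ℝ[X]} (h : P ∣ A) :
    P ^ n ∣ boggioPolynomial n A D := by
  refine Dvd.dvd.mul_left (Finset.dvd_sum fun j _ => Dvd.dvd.mul_left (Dvd.dvd.mul_right ?_ _) _) _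
  exact (pow_dvd_pow_of_dvd h n).trans (pow_dvd_pow _ (by omega))

-- Each summand has degree at most (n+j) + (n-1-j) = 2n-1 when A and D are affine.
open Polynomial in
theorem degree_boggioPolynomial_lt {n : ℕ} (hn : 1 ≤ n) {A D : ℝ[X]} (hA : A.natDegree ≤ 1)
    (hD : D.natDegree ≤ 1) : (boggioPolynomial n A D).degree < (2 * n : ℕ) := by
  refine lt_of_le_of_lt degree_le_natDegree ?_
  refine Nat.cast_lt.2 (lt_of_le_of_lt (natDegree_C_mul_le _ _)
    (lt_of_le_of_lt (natDegree_sum_le_of_forall_le (n := 2 * n - 1) _ _ fun j hj => ?_) (by omega)))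
  have hj' := Finset.mem_range.1 hj
  refine (natDegree_C_mul_le _ _).trans (natDegree_mul_le.trans ?_)
  have h1 : (A ^ (n + j)).natDegree ≤ n + j :=
    natDegree_pow_le.trans (by nlinarith)
  have h2D : (2 * D).natDegree ≤ 1 := by
    have := natDegree_C_mul_le 2 D
    exact this.trans hD
  have h2 : ((2 * D) ^ (n - 1 - j)).natDegree ≤ n - 1 - j :=
    natDegree_pow_le.trans (by nlinarith)
  omega

-- The branch t ≤ s of `boggioKernel`, where both arguments of `boggioPrimitive` are affine in t.
open Polynomial in
noncomputable def boggioLeft (n : ℕ) (s : ℝ) : ℝ[X] :=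
  boggioPolynomial n ((X - C (-1)) * C (1 - s)) (C s - X)

open Polynomial in
noncomputable def boggioRight (n : ℕ) (s : ℝ) : ℝ[X] :=
  boggioPolynomial n ((X - C 1) * C (-(1 + s))) (X - C s)

open Polynomial in
theorem isGreenPair_boggio {n : ℕ} (hn : 1 ≤ n) (s : ℝ) :
    IsGreenPair n s (boggioLeft n s) (boggioRight n s) where
  degree_left := degree_boggioPolynomial_lt hn (by compute_degree) (by compute_degree)
  degree_right := degree_boggioPolynomial_lt hn (by compute_degree) (by compute_degree)
  dvd_left := pow_dvd_boggioPolynomial n (dvd_mul_right _ _)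
  dvd_right := pow_dvd_boggioPolynomial n (dvd_mul_right _ _)
  jump := by
    refine Polynomial.funext fun t => ?_
    simp only [boggioLeft, boggioRight, eval_sub, eval_boggioPolynomial, eval_mul, eval_C, eval_X,
      eval_pow]
    -- With c = 1-ts and d = t-s one has (1-t)(1+s) = c-d and (1+t)(1-s) = c+d.
    rw [← boggioPrimitive_sub_boggioPrimitive hn (1 - t * s) (t - s)]
    congr 2 <;> ring

theorem boggioKernel_eq_left {n : ℕ} {t s : ℝ} (h : t ≤ s) :
    boggioKernel n t s = (boggioLeft n s).eval t := by
  rw [boggioKernel, boggioLeft, eval_boggioPolynomial, max_eq_right h, min_eq_left h,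
    abs_of_nonpos (sub_nonpos.2 h)]
  simp only [Polynomial.eval_mul, Polynomial.eval_sub, Polynomial.eval_X, Polynomial.eval_C]
  congr 1 <;> ring

theorem boggioKernel_eq_right {n : ℕ} {t s : ℝ} (h : s ≤ t) :
    boggioKernel n t s = (boggioRight n s).eval t := by
  rw [boggioKernel, boggioRight, eval_boggioPolynomial, max_eq_left h, min_eq_right h,
    abs_of_nonneg (sub_nonneg.2 h)]
  simp only [Polynomial.eval_mul, Polynomial.eval_sub, Polynomial.eval_X, Polynomial.eval_C]
  congr 1; ring

theorem greenFunction_eq_boggioKernel {n : ℕ} (hn : 1 ≤ n) {t s : ℝ} (ht : t ∈ Ioo (-1 : ℝ) 1)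
    (hs : s ∈ Ioo (-1 : ℝ) 1) : greenFunction n t s = boggioKernel n t s := by
  obtain ⟨L, R, hLR, hL, hR⟩ := (isGreenFunction_greenFunction n hn).exists_isGreenPair hn hs
  obtain ⟨h1, h2⟩ := hLR.unique (isGreenPair_boggio hn s)
  rcases le_total t s with h | h
  · rw [hL t ⟨ht.1.le, h⟩, h1, boggioKernel_eq_left h]
  · rw [hR t ⟨h, ht.2.le⟩, h2, boggioKernel_eq_right h]

/-! ### Integration by parts and the representation formula -/

theorem ContDiff.hasDerivAt_iteratedDeriv {𝕜 : Type*} [RCLike 𝕜] {u : ℝ → 𝕜}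
    (hu : ContDiff ℝ (⊤ : ℕ∞) u) (m : ℕ) (x : ℝ) :
    HasDerivAt (iteratedDeriv m u) (iteratedDeriv (m + 1) u x) x := by
  rw [iteratedDeriv_succ]
  exact ((hu.differentiable_iteratedDeriv m (by exact_mod_cast WithTop.coe_lt_top m)) x).hasDerivAt

theorem ContDiff.continuous_iteratedDeriv_of_top {𝕜 : Type*} [RCLike 𝕜] {u : ℝ → 𝕜}
    (hu : ContDiff ℝ (⊤ : ℕ∞) u) (m : ℕ) : Continuous (iteratedDeriv m u) :=
  hu.continuous_iteratedDeriv m (by exact_mod_cast le_top)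

open Polynomial in
/-- Repeated integration by parts against a polynomial. -/
theorem integral_polynomial_smul_iteratedDeriv {𝕜 : Type*} [RCLike 𝕜] {u : ℝ → 𝕜}
    (hu : ContDiff ℝ (⊤ : ℕ∞) u) (a b : ℝ) (m : ℕ) (p : ℝ[X]) :
    ∫ s in a..b, p.eval s • iteratedDeriv m u s =
      (∑ j ∈ Finset.range m,
          ((-1) ^ j * (derivative^[j] p).eval b) • iteratedDeriv (m - 1 - j) u b)
        - (∑ j ∈ Finset.range m,
          ((-1) ^ j * (derivative^[j] p).eval a) • iteratedDeriv (m - 1 - j) u a)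
        + (-1 : ℝ) ^ m • ∫ s in a..b, (derivative^[m] p).eval s • u s := by
  induction m generalizing p with
  | zero => simp
  | succ m ih =>
    have h1 := intervalIntegral.integral_smul_deriv_eq_deriv_smul (a := a) (b := b)
      (u := fun s => p.eval s) (v := iteratedDeriv m u) (u' := fun s => (derivative p).eval s)
      (v' := iteratedDeriv (m + 1) u) (fun x _ => p.hasDerivAt x)
      (fun x _ => hu.hasDerivAt_iteratedDeriv m x)
      ((derivative p).continuous.intervalIntegrable _ _)
      ((hu.continuous_iteratedDeriv_of_top (m + 1)).intervalIntegrable _ _)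
    have h2 : ∀ x, ∑ j ∈ Finset.range (m + 1),
        ((-1) ^ j * (derivative^[j] p).eval x) • iteratedDeriv (m + 1 - 1 - j) u x
        = p.eval x • iteratedDeriv m u x - ∑ j ∈ Finset.range m,
          ((-1) ^ j * (derivative^[j] (derivative p)).eval x) • iteratedDeriv (m - 1 - j) u x := by
      intro x
      rw [Finset.sum_range_succ', add_comm, sub_eq_add_neg, ← Finset.sum_neg_distrib]
      congr 1
      · simp
      · refine Finset.sum_congr rfl fun j _ => ?_
        rw [← neg_smul, Function.iterate_succ_apply, show m + 1 - 1 - (j + 1) = m - 1 - j by omega,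
          pow_succ]
        congr 1
        ring
    rw [h1, ih (derivative p), h2 a, h2 b, Function.iterate_succ_apply, pow_succ, mul_neg_one,
      neg_smul]
    abel

theorem integral_intervalMeasure {E : Type*} [NormedAddCommGroup E] [NormedSpace ℝ E]
    (f : ℝ → E) : ∫ s, f s ∂intervalMeasure = ∫ s in (-1 : ℝ)..1, f s := by
  rw [intervalIntegral.integral_of_le (by norm_num), intervalMeasure,
    integral_Ioc_eq_integral_Ioo]

/-- Green's representation formula. -/
theorem integral_boggioKernel_mul_iteratedDeriv {𝕜 : Type*} [RCLike 𝕜] {n : ℕ} (hn : 1 ≤ n)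
    {u : ℝ → 𝕜} (hu : ContDiff ℝ (⊤ : ℕ∞) u) (hl : ∀ j < n, iteratedDeriv j u (-1) = 0)
    (hr : ∀ j < n, iteratedDeriv j u 1 = 0) {t : ℝ} (ht : t ∈ Ioo (-1 : ℝ) 1) :
    ∫ s, (boggioKernel n t s : 𝕜) * ((-1) ^ n * iteratedDeriv (2 * n) u s) ∂intervalMeasure
      = u t := by
  have hP := isGreenPair_boggio hn t
  set L := boggioLeft n t with hLdef
  set R := boggioRight n t with hRdef
  have hcont : Continuous (fun s => boggioKernel n t s • iteratedDeriv (2 * n) u s) :=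
    ((continuous_boggioKernel n).comp (by fun_prop : Continuous fun s : ℝ => (t, s))).smul
      (hu.continuous_iteratedDeriv_of_top _)
  have h1 : ∀ s, (boggioKernel n t s : 𝕜) * ((-1) ^ n * iteratedDeriv (2 * n) u s)
      = (-1 : ℝ) ^ n • (boggioKernel n t s • iteratedDeriv (2 * n) u s) := by
    intro s
    rw [RCLike.real_smul_eq_coe_mul, RCLike.real_smul_eq_coe_mul]
    push_cast
    ring
  simp only [h1]
  rw [integral_smul, integral_intervalMeasure,
    ← intervalIntegral.integral_add_adjacent_intervals (b := t)
      (hcont.intervalIntegrable _ _) (hcont.intervalIntegrable _ _)]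
  have hIL : ∫ s in (-1 : ℝ)..t, boggioKernel n t s • iteratedDeriv (2 * n) u s
      = ∫ s in (-1 : ℝ)..t, L.eval s • iteratedDeriv (2 * n) u s := by
    refine intervalIntegral.integral_congr fun s hs => ?_
    rw [uIcc_of_le ht.1.le] at hs
    -- By symmetry t becomes the source point, so the kernel is piecewise polynomial in s.
    rw [boggioKernel_comm, boggioKernel_eq_left hs.2]
  have hIR : ∫ s in t..1, boggioKernel n t s • iteratedDeriv (2 * n) u s
      = ∫ s in t..1, R.eval s • iteratedDeriv (2 * n) u s := by
    refine intervalIntegral.integral_congr fun s hs => ?_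
    rw [uIcc_of_le ht.2.le] at hs
    rw [boggioKernel_comm, boggioKernel_eq_right hs.1]
  rw [hIL, hIR, integral_polynomial_smul_iteratedDeriv hu,
    integral_polynomial_smul_iteratedDeriv hu,
    Polynomial.iterate_derivative_eq_zero_of_degree_lt hP.degree_left,
    Polynomial.iterate_derivative_eq_zero_of_degree_lt hP.degree_right]
  -- In every boundary term either the polynomial is differentiated fewer than n times or `u` is,
  -- since the orders add up to 2n-1.
  have hbl : ∑ j ∈ Finset.range (2 * n), ((-1) ^ j * (Polynomial.derivative^[j] L).eval (-1)) •
      iteratedDeriv (2 * n - 1 - j) u (-1) = 0 := by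
    refine Finset.sum_eq_zero fun j hj => ?_
    rcases lt_or_ge j n with h | h
    · rw [iterate_derivative_eval_eq_zero_of_dvd hP.dvd_left h, mul_zero, zero_smul]
    · rw [hl _ (by omega), smul_zero]
  have hbr : ∑ j ∈ Finset.range (2 * n), ((-1) ^ j * (Polynomial.derivative^[j] R).eval 1) •
      iteratedDeriv (2 * n - 1 - j) u 1 = 0 := by
    refine Finset.sum_eq_zero fun j hj => ?_
    rcases lt_or_ge j n with h | h
    · rw [iterate_derivative_eval_eq_zero_of_dvd hP.dvd_right h, mul_zero, zero_smul]
    · rw [hr _ (by omega), smul_zero]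
  rw [hbl, hbr]
  -- R - L is a multiple of (X-t)^(2n-1), so only j = 2n-1 survives, and this oddness gives the
  -- minus sign.
  have hjump : (∑ j ∈ Finset.range (2 * n), ((-1) ^ j * (Polynomial.derivative^[j] R).eval t) •
      iteratedDeriv (2 * n - 1 - j) u t)
      - ∑ j ∈ Finset.range (2 * n), ((-1) ^ j * (Polynomial.derivative^[j] L).eval t) •
      iteratedDeriv (2 * n - 1 - j) u t = -((-1 : ℝ) ^ n • u t) := by
    rw [← Finset.sum_sub_distrib]
    rw [Finset.sum_eq_single (2 * n - 1)]
    · rw [← sub_smul, ← mul_sub, ← Polynomial.eval_sub, ← Polynomial.iterate_derivative_sub,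
        hP.jump, Polynomial.iterate_derivative_C_mul, Polynomial.iterate_derivative_X_sub_pow_self,
        Nat.sub_self, iteratedDeriv_zero]
      have h0 : ((2 * n - 1)! : ℝ) ≠ 0 := by positivity
      have hodd : Odd (2 * n - 1) := ⟨n - 1, by omega⟩
      rw [hodd.neg_one_pow]
      simp [h0]
    · intro j hj hne
      rw [← sub_smul, ← mul_sub, ← Polynomial.eval_sub, ← Polynomial.iterate_derivative_sub,
        hP.jump, iterate_derivative_eval_eq_zero_of_dvd (dvd_mul_left _ _)
          (by have := Finset.mem_range.1 hj; omega), mul_zero, zero_smul]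
    · intro h
      exact absurd (Finset.mem_range.2 (by omega)) h
  simp only [Polynomial.eval_zero, zero_smul, intervalIntegral.integral_zero, smul_zero, add_zero,
    sub_zero, zero_sub]
  rw [← sub_eq_add_neg, ← neg_sub, hjump, neg_neg, smul_smul, ← pow_add, ← two_mul, pow_mul]
  simp

/-! ### Rising factorials and the hypergeometric coefficients -/

/-- The rising factorial `(x)_k` (Pochhammer symbol). -/
noncomputable abbrev risingFactorial (k : ℕ) (x : ℝ) : ℝ := (ascPochhammer ℝ k).eval x

@[simp] theorem risingFactorial_zero (x : ℝ) : risingFactorial 0 x = 1 := by simp [risingFactorial]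

theorem risingFactorial_succ (k : ℕ) (x : ℝ) :
    risingFactorial (k + 1) x = risingFactorial k x * (x + k) :=
  ascPochhammer_succ_eval k x

theorem risingFactorial_add (k m : ℕ) (x : ℝ) :
    risingFactorial (k + m) x = risingFactorial k x * risingFactorial m (x + k) := by
  induction m with
  | zero => simp
  | succ m ih =>
    rw [← add_assoc, risingFactorial_succ, ih, risingFactorial_succ m]
    push_cast
    ring

theorem risingFactorial_succ' (k : ℕ) (x : ℝ) :
    risingFactorial (k + 1) x = x * risingFactorial k (x + 1) := by
  rw [add_comm k 1, risingFactorial_add, risingFactorial_succ, risingFactorial_zero]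
  simp

theorem risingFactorial_pos {x : ℝ} (hx : 0 < x) (k : ℕ) : 0 < risingFactorial k x :=
  ascPochhammer_pos k x hx

theorem risingFactorial_reflect (k : ℕ) (x : ℝ) :
    risingFactorial k x = (-1) ^ k * risingFactorial k (-x - k + 1) := by
  induction k with
  | zero => simp
  | succ k ih =>
    rw [risingFactorial_succ, ih, risingFactorial_succ', pow_succ]
    push_cast
    rw [show -x - (k + 1) + 1 + 1 = -x - k + 1 by ring]
    ring

theorem risingFactorial_natCast_add_one (m k : ℕ) :
    risingFactorial k (m + 1 : ℝ) = ((m + k)! : ℝ) / m ! := by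
  have h0 : (m ! : ℝ) ≠ 0 := by positivity
  induction k with
  | zero => simp [h0]
  | succ k ih =>
    rw [risingFactorial_succ, ih, ← add_assoc, Nat.factorial_succ]
    push_cast
    ring

theorem four_pow_mul_factorial_mul_risingFactorial_half (m : ℕ) :
    ((2 * m)! : ℝ) = 4 ^ m * m ! * risingFactorial m (1 / 2) := by
  induction m with
  | zero => simp
  | succ m ih =>
    rw [show 2 * (m + 1) = 2 * m + 1 + 1 by ring, Nat.factorial_succ, Nat.factorial_succ,
      Nat.factorial_succ, risingFactorial_succ]
    push_cast
    rw [ih]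
    ring

/-- The Chu–Vandermonde identity. -/
theorem sum_choose_mul_risingFactorial (N : ℕ) (a c : ℝ) :
    ∑ i ∈ Finset.range (N + 1), (N.choose i : ℝ) *
        ((-1) ^ i * risingFactorial i a * risingFactorial (N - i) (c + i))
      = risingFactorial N (c - a) := by
  induction N generalizing a c with
  | zero => simp
  | succ N ih =>
    -- Pascal's rule splits the sum in two: the unshifted half gains a factor c+N, while the shifted
    -- half is -a times the sum for (a+1, c+1), which has the same difference c-a.
    have h1 := Finset.sum_choose_succ_mul (R := ℝ)
      (fun i k => (-1) ^ i * risingFactorial i a * risingFactorial k (c + i)) N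
    have h2 : ∑ i ∈ Finset.range (N + 1), (N.choose i : ℝ) *
        ((-1) ^ i * risingFactorial i a * risingFactorial (N + 1 - i) (c + i))
        = (c + N) * risingFactorial N (c - a) := by
      rw [← ih, Finset.mul_sum]
      refine Finset.sum_congr rfl fun i hi => ?_
      have hi' : i ≤ N := Nat.lt_succ_iff.1 (Finset.mem_range.1 hi)
      rw [Nat.succ_sub hi', risingFactorial_succ, Nat.cast_sub hi']
      ring
    have h3 : ∑ i ∈ Finset.range (N + 1), (N.choose i : ℝ) *
        ((-1) ^ (i + 1) * risingFactorial (i + 1) a * risingFactorial (N - i) (c + (i + 1 : ℕ)))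
        = -(a * risingFactorial N (c - a)) := by
      have h4 := ih (a + 1) (c + 1)
      rw [show c + 1 - (a + 1) = c - a by ring] at h4
      rw [← h4, Finset.mul_sum, ← Finset.sum_neg_distrib]
      refine Finset.sum_congr rfl fun i _ => ?_
      rw [risingFactorial_succ', pow_succ]
      push_cast
      rw [show c + ((i : ℝ) + 1) = c + 1 + i by ring]
      ring
    refine h1.trans ?_
    rw [h2, h3, risingFactorial_succ]
    ring

/-- The terms of the series `hypergeometricRatio`. -/
noncomputable def hypergeometricTerm (n k : ℕ) : ℝ :=
  risingFactorial k (1 / 2) * risingFactorial k 1 * risingFactorial k (-n) /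
    (risingFactorial k (1 - 2 * n) * risingFactorial k (n + 1) * k !)

theorem hypergeometricRatio_eq (n : ℕ) :
    hypergeometricRatio n = ∑ k ∈ Finset.range (n + 1), hypergeometricTerm n k := rfl

/-- Reflecting the symbols (-n)_k and (1-2n)_k produces signs that cancel, and (1)_k cancels k!. For
k ≤ n and n ≥ 1 every remaining factor is visibly positive. -/
theorem hypergeometricTerm_eq (n k : ℕ) : hypergeometricTerm n k =
    risingFactorial k (1 / 2) * risingFactorial k (n - k + 1) /
      (risingFactorial k (2 * n - k) * risingFactorial k (n + 1)) := by
  have h1 : risingFactorial k 1 = k ! := by simp [risingFactorial, ascPochhammer_eval_one]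
  have h0 : (k ! : ℝ) ≠ 0 := by positivity
  rw [hypergeometricTerm, h1, risingFactorial_reflect k (-n), risingFactorial_reflect k (1 - 2 * n),
    show -(-(n : ℝ)) - k + 1 = n - k + 1 by ring,
    show -(1 - 2 * (n : ℝ)) - k + 1 = 2 * n - k by ring]
  have hs : ((-1 : ℝ) ^ k) ≠ 0 := by positivity
  rw [show risingFactorial k (1 / 2) * (k ! : ℝ) * ((-1) ^ k * risingFactorial k (n - k + 1))
      = ((-1) ^ k * k !) * (risingFactorial k (1 / 2) * risingFactorial k (n - k + 1)) by ring,
    show (-1) ^ k * risingFactorial k (2 * (n : ℝ) - k) * risingFactorial k (n + 1) * (k ! : ℝ)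
      = ((-1) ^ k * k !) * (risingFactorial k (2 * n - k) * risingFactorial k (n + 1)) by ring,
    mul_div_mul_left _ _ (mul_ne_zero hs h0)]

theorem hypergeometricTerm_pos {n k : ℕ} (hn : 1 ≤ n) (hk : k ≤ n) :
    0 < hypergeometricTerm n k := by
  have h1 : (k : ℝ) ≤ n := by exact_mod_cast hk
  have h2 : (1 : ℝ) ≤ n := by exact_mod_cast hn
  rw [hypergeometricTerm_eq]
  exact div_pos (mul_pos (risingFactorial_pos (by norm_num) _) (risingFactorial_pos (by linarith) _))
    (mul_pos (risingFactorial_pos (by linarith) _) (risingFactorial_pos (by linarith) _))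

theorem Gamma_add_natCast {x : ℝ} (hx : 0 < x) (k : ℕ) :
    Real.Gamma (x + k) = risingFactorial k x * Real.Gamma x := by
  induction k with
  | zero => simp
  | succ k ih =>
    push_cast
    rw [← add_assoc, Real.Gamma_add_one (by positivity), ih, risingFactorial_succ]
    ring

/-- The constant `α_n` in `lowerFactor`. -/
noncomputable def greenConstant (n : ℕ) : ℝ :=
  Real.Gamma (n + 1 / 2) / (2 * Real.Gamma (n + 1) * Real.Gamma (2 * n + 1 / 2))

theorem lowerFactor_eq (n : ℕ) : lowerFactor n = √2 * (2 * n)! * greenConstant n := rfl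

theorem greenConstant_eq (n : ℕ) :
    greenConstant n = 1 / (2 * n ! * risingFactorial n (n + 1 / 2)) := by
  have h1 : Real.Gamma (2 * n + 1 / 2)
      = risingFactorial n (n + 1 / 2) * Real.Gamma (n + 1 / 2) := by
    rw [← Gamma_add_natCast (by positivity)]
    ring_nf
  have h2 : Real.Gamma (n + 1 / 2 : ℝ) ≠ 0 := (Real.Gamma_pos_of_pos (by positivity)).ne'
  have h3 : risingFactorial n (n + 1 / 2 : ℝ) ≠ 0 := (risingFactorial_pos (by positivity) _).ne'
  have h4 : (n ! : ℝ) ≠ 0 := by positivity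
  rw [greenConstant, h1, Real.Gamma_nat_eq_factorial]
  field_simp

theorem greenConstant_pos (n : ℕ) : 0 < greenConstant n := by
  rw [greenConstant_eq]
  have := risingFactorial_pos (x := n + 1 / 2) (by positivity) n
  positivity

/-- Both sides are (2n)!/n!. -/
theorem two_mul_risingFactorial_self {n : ℕ} (hn : 1 ≤ n) :
    2 * risingFactorial n (n : ℝ) = 4 ^ n * risingFactorial n (1 / 2) := by
  obtain ⟨m, rfl⟩ : ∃ m, n = m + 1 := ⟨n - 1, by omega⟩
  have h1 := risingFactorial_natCast_add_one m (m + 1)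
  have h2 := four_pow_mul_factorial_mul_risingFactorial_half (m + 1)
  have h0 : (m ! : ℝ) ≠ 0 := by positivity
  push_cast
  rw [h1]
  rw [show 2 * (m + 1) = m + (m + 1) + 1 by ring, Nat.factorial_succ, Nat.factorial_succ m] at h2
  have h3 : (m + 1 : ℝ) ≠ 0 := by positivity
  push_cast at h2
  rw [mul_div_assoc', div_eq_iff h0]
  apply mul_left_cancel₀ h3
  linear_combination h2

/-- The shift k = j+i brings the summand into Chu–Vandermonde form with N = n-j, a = 1/2+j and c =
1-2n+j; the prefactor is free of i. -/
theorem hypergeometricTerm_mul_choose {n j i : ℕ} (hn : 1 ≤ n) (hji : j + i ≤ n) :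
    hypergeometricTerm n (j + i) * ((n + (j + i)).choose (n + j) : ℝ)
      = (risingFactorial j (1 / 2) * n ! ^ 2 * (-1) ^ (n - j) /
          ((n + j)! * (n - j)! * risingFactorial n n)) *
        (((n - j).choose i : ℝ) * ((-1) ^ i * risingFactorial i (1 / 2 + j) *
          risingFactorial (n - j - i) (1 - 2 * n + j + i))) := by
  have hn' : (1 : ℝ) ≤ n := by exact_mod_cast hn
  obtain ⟨l, rfl⟩ : ∃ l, n = j + i + l := ⟨n - (j + i), by omega⟩
  set n := j + i + l with hn_def
  have e1 : n - j = i + l := by omega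
  have e2 : n - j - i = l := by omega
  rw [e2, e1, hypergeometricTerm_eq]
  have hc1 : ((n + (j + i)).choose (n + j) : ℝ) = (n + (j + i))! / ((n + j)! * i !) := by
    rw [Nat.cast_choose ℝ (by omega), show n + (j + i) - (n + j) = i by omega]
  have hc2 : ((i + l).choose i : ℝ) = (i + l)! / (i ! * l !) := by
    rw [Nat.cast_choose ℝ (by omega), show i + l - i = l by omega]
  have hp1 : risingFactorial (j + i) (n - (j + i : ℕ) + 1 : ℝ) = n ! / l ! := by
    have := risingFactorial_natCast_add_one l (j + i)
    rw [show (n : ℝ) - (j + i : ℕ) = l by rw [hn_def]; push_cast; ring, this,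
      show l + (j + i) = n by omega]
  have hp2 : risingFactorial (j + i) (n + 1 : ℝ) = (n + (j + i))! / n ! :=
    risingFactorial_natCast_add_one n (j + i)
  have hp3 : risingFactorial n (n : ℝ) = risingFactorial l n *
      risingFactorial (j + i) (2 * n - (j + i : ℕ)) := by
    conv_lhs => rw [show n = l + (j + i) by omega, risingFactorial_add]
    rw [show ((l + (j + i) : ℕ) : ℝ) = n by rw [hn_def]; push_cast; ring]
    rw [show (n : ℝ) + l = 2 * n - (j + i : ℕ) by rw [hn_def]; push_cast; ring]
  have hp4 : risingFactorial l (1 - 2 * n + j + i : ℝ) = (-1) ^ l * risingFactorial l n := by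
    rw [risingFactorial_reflect]
    congr 2
    rw [hn_def]; push_cast; ring
  have hl : risingFactorial l (n : ℝ) ≠ 0 := (risingFactorial_pos (by linarith) _).ne'
  have hk : (0 : ℝ) < 2 * n - (j + i : ℕ) := by
    have : ((j + i : ℕ) : ℝ) ≤ n := by exact_mod_cast hji
    linarith
  have hk' := (risingFactorial_pos hk (j + i)).ne'
  have f1 : ((n + j)! : ℝ) ≠ 0 := by positivity
  have f2 : ((n + (j + i))! : ℝ) ≠ 0 := by positivity
  have f3 : (n ! : ℝ) ≠ 0 := by positivity
  have f4 : (l ! : ℝ) ≠ 0 := by positivity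
  have f5 : (i ! : ℝ) ≠ 0 := by positivity
  have f6 : ((i + l)! : ℝ) ≠ 0 := by positivity
  rw [hc1, hc2, hp1, hp2, hp3, hp4, risingFactorial_add j i, pow_add]
  have hs1 : ((-1 : ℝ) ^ i) * (-1) ^ i = 1 := by rw [← mul_pow]; simp
  have hs2 : ((-1 : ℝ) ^ l) * (-1) ^ l = 1 := by rw [← mul_pow]; simp
  generalize risingFactorial l (n : ℝ) = A at *
  generalize risingFactorial (j + i) (2 * (n : ℝ) - (j + i : ℕ)) = B at *
  generalize risingFactorial j (1 / 2 : ℝ) = D at *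
  generalize risingFactorial i (1 / 2 + j : ℝ) = E at *
  generalize ((-1 : ℝ) ^ i) = S at *
  generalize ((-1 : ℝ) ^ l) = T at *
  field_simp
  have hs3 : S ^ 2 = 1 := by rw [sq, hs1]
  have hs4 : T ^ 2 = 1 := by rw [sq, hs2]
  simp [hs3, hs4]

/-- Up to sign, this compares the coefficients of X^(2j) in the equation saying that α_n Σ c_k
(1-X²)^(n+k) has 2n-th derivative (-1)^n (1-X²)^n. -/
theorem sum_hypergeometricTerm_mul_choose {n : ℕ} (hn : 1 ≤ n) (j : ℕ) :
    greenConstant n * ((2 * n + 2 * j)! / (2 * j)! : ℝ) *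
      ∑ k ∈ Finset.range (n + 1), hypergeometricTerm n k * ((n + k).choose (n + j) : ℝ)
        = (n.choose j : ℝ) := by
  rcases lt_or_ge n j with hj | hj
  · rw [Nat.choose_eq_zero_of_lt hj, Finset.sum_eq_zero]
    · simp
    · intro k hk
      rw [Nat.choose_eq_zero_of_lt (by have := Finset.mem_range.1 hk; omega)]
      simp
  obtain ⟨N, rfl⟩ : ∃ N, n = j + N := ⟨n - j, by omega⟩
  set n := j + N with hn_def
  have hsum : ∑ k ∈ Finset.range (n + 1),
      hypergeometricTerm n k * ((n + k).choose (n + j) : ℝ)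
      = (risingFactorial j (1 / 2) * n ! ^ 2 * (-1) ^ N / ((n + j)! * N ! * risingFactorial n n))
        * ((-1) ^ N * risingFactorial N (n + j + 1 / 2)) := by
    have h0 : ∑ k ∈ Finset.range j, hypergeometricTerm n k * ((n + k).choose (n + j) : ℝ) = 0 := by
      refine Finset.sum_eq_zero fun k hk => ?_
      rw [Nat.choose_eq_zero_of_lt (by have := Finset.mem_range.1 hk; omega)]
      simp
    rw [show n + 1 = j + (N + 1) by omega, Finset.sum_range_add, h0, zero_add]
    have e : n - j = N := by omega
    rw [show (-1) ^ N * risingFactorial N ((n : ℝ) + j + 1 / 2)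
      = risingFactorial N ((1 - 2 * n + j) - (1 / 2 + j)) by
        rw [risingFactorial_reflect N ((1 - 2 * n + j) - (1 / 2 + j))]
        congr 2
        rw [hn_def]; push_cast; ring]
    rw [← sum_choose_mul_risingFactorial, Finset.mul_sum]
    refine Finset.sum_congr rfl fun i hi => ?_
    have := Finset.mem_range.1 hi
    rw [hypergeometricTerm_mul_choose hn (by omega), e]
  have g1 := four_pow_mul_factorial_mul_risingFactorial_half (n + j)
  have g2 := four_pow_mul_factorial_mul_risingFactorial_half j
  have g3 := two_mul_risingFactorial_self hn
  -- Both products are splittings of (1/2)_(2n); this removes the dependence on j that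
  -- Chu–Vandermonde leaves.
  have g4 : risingFactorial (n + j) (1 / 2 : ℝ) * risingFactorial N (n + j + 1 / 2)
      = risingFactorial n (1 / 2) * risingFactorial n (n + 1 / 2) := by
    have a1 := risingFactorial_add (n + j) N (1 / 2)
    have a2 := risingFactorial_add n n (1 / 2)
    rw [show n + j + N = n + n by omega, a2] at a1
    rw [show (n : ℝ) + j + 1 / 2 = 1 / 2 + (n + j : ℕ) by push_cast; ring, ← a1,
      show (n : ℝ) + 1 / 2 = 1 / 2 + n by ring]
  rw [hsum, greenConstant_eq, show 2 * n + 2 * j = 2 * (n + j) by ring, g1, g2,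
    Nat.cast_choose ℝ hj, show n - j = N by omega]
  have p1 := (risingFactorial_pos (x := 1 / 2) (by norm_num) j).ne'
  have p2 := (risingFactorial_pos (x := 1 / 2) (by norm_num) n).ne'
  have p3 := (risingFactorial_pos (x := n + 1 / 2) (by positivity) n).ne'
  have p4 : risingFactorial n (n : ℝ) = 4 ^ n * risingFactorial n (1 / 2) / 2 := by linarith
  have hs : ((-1 : ℝ) ^ N) * (-1) ^ N = 1 := by rw [← mul_pow]; simp
  rw [p4, pow_add]
  have f1 : ((n + j)! : ℝ) ≠ 0 := by positivity
  have f3 : (n ! : ℝ) ≠ 0 := by positivity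
  have f4 : (N ! : ℝ) ≠ 0 := by positivity
  have f5 : (j ! : ℝ) ≠ 0 := by positivity
  generalize risingFactorial j (1 / 2 : ℝ) = A at *
  generalize risingFactorial n (1 / 2 : ℝ) = B at *
  generalize risingFactorial n (n + 1 / 2 : ℝ) = D at *
  generalize risingFactorial (n + j) (1 / 2 : ℝ) = E at *
  generalize risingFactorial N (n + j + 1 / 2 : ℝ) = F at *
  generalize ((-1 : ℝ) ^ N) = S at *
  have hs2 : S ^ 2 = 1 := by rw [sq, hs]
  field_simp
  linear_combination (E * F) * hs2 + g4

/-! ### Exact integrals of the kernel against polynomials -/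

-- The divisibility supplies the boundary conditions, so the representation formula applies to U.
-- Evaluating T_n on a polynomial thus becomes a matter of differentiating a polynomial.
open Polynomial in
theorem integral_boggioKernel_mul_polynomial {n : ℕ} (hn : 1 ≤ n) {U V : ℝ[X]}
    (hU : (1 - X ^ 2) ^ n ∣ U) (hV : derivative^[2 * n] U = (-1) ^ n * V) {t : ℝ}
    (ht : t ∈ Ioo (-1 : ℝ) 1) :
    ∫ s, boggioKernel n t s * V.eval s ∂intervalMeasure = U.eval t := by
  have hder : ∀ j x, iteratedDeriv j (fun s => U.eval s) x = (derivative^[j] U).eval x := by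
    intro j x
    have := iteratedDerivWithin_polynomial (g := fun s => U.eval s) U
      (show x - 1 < x + 1 by linarith) j (t := x) ⟨by linarith, by linarith⟩ (fun _ _ => rfl)
    rw [← this, iteratedDerivWithin_eq_iteratedDeriv (uniqueDiffOn_Icc (by linarith))
      (contDiff_polynomial_eval U).contDiffAt ⟨by linarith, by linarith⟩]
  have h1 : (X - C (1 : ℝ)) ^ n ∣ U :=
    (pow_dvd_pow_of_dvd ⟨-(1 + X), by simp; ring⟩ n).trans hU
  have h2 : (X - C (-1 : ℝ)) ^ n ∣ U :=
    (pow_dvd_pow_of_dvd ⟨1 - X, by simp; ring⟩ n).trans hU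
  have := integral_boggioKernel_mul_iteratedDeriv (𝕜 := ℝ) hn (u := fun s => U.eval s)
    (contDiff_polynomial_eval U)
    (fun j hj => by rw [hder]; exact iterate_derivative_eval_eq_zero_of_dvd h2 hj)
    (fun j hj => by rw [hder]; exact iterate_derivative_eval_eq_zero_of_dvd h1 hj) ht
  rw [← this]
  refine integral_congr_ae (Filter.Eventually.of_forall fun s => ?_)
  have hs : ((-1 : ℝ) ^ n) * (-1) ^ n = 1 := by rw [← mul_pow]; simp
  simp only [hder, hV, eval_mul, eval_pow, eval_neg, eval_one, RCLike.ofReal_real_eq_id, id]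
  rw [← mul_assoc ((-1 : ℝ) ^ n), hs, one_mul]

open Polynomial in
theorem one_sub_X_sq_pow_eq_expand (m : ℕ) :
    (1 - X ^ 2 : ℝ[X]) ^ m = expand ℝ 2 (((1 + X) ^ m).comp (C (-1) * X)) := by
  simp [sub_eq_add_neg]

open Polynomial in
theorem coeff_one_sub_X_sq_pow_two_mul (m i : ℕ) :
    ((1 - X ^ 2 : ℝ[X]) ^ m).coeff (2 * i) = (-1) ^ i * (m.choose i : ℝ) := by
  rw [one_sub_X_sq_pow_eq_expand, coeff_expand_mul' (by norm_num), comp_C_mul_X_coeff,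
    coeff_one_add_X_pow]
  ring

open Polynomial in
theorem coeff_one_sub_X_sq_pow_of_odd (m : ℕ) {e : ℕ} (he : ¬ 2 ∣ e) :
    ((1 - X ^ 2 : ℝ[X]) ^ m).coeff e = 0 := by
  rw [one_sub_X_sq_pow_eq_expand, coeff_expand (by norm_num), if_neg he]

open Polynomial in
theorem iterate_derivative_sum_one_sub_X_sq_pow {n : ℕ} (hn : 1 ≤ n) :
    derivative^[2 * n] (C (greenConstant n) * ∑ k ∈ Finset.range (n + 1),
      C (hypergeometricTerm n k) * (1 - X ^ 2) ^ (n + k)) = (-1) ^ n * (1 - X ^ 2) ^ n := by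
  ext e
  have hsgn : ((-1 : ℝ[X]) ^ n) = C ((-1) ^ n) := by simp
  rw [coeff_iterate_derivative, coeff_C_mul, finsetSum_coeff, hsgn, coeff_C_mul]
  simp only [coeff_C_mul]
  by_cases he : 2 ∣ e
  · obtain ⟨j, rfl⟩ := he
    have h1 : 2 * j + 2 * n = 2 * (n + j) := by ring
    simp only [h1, coeff_one_sub_X_sq_pow_two_mul]
    rw [← sum_hypergeometricTerm_mul_choose hn j]
    have h2 : ((2 * (n + j)).descFactorial (2 * n) : ℝ) = (2 * n + 2 * j)! / (2 * j)! := by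
      have := Nat.factorial_mul_descFactorial (show 2 * n ≤ 2 * (n + j) by omega)
      rw [show 2 * (n + j) - 2 * n = 2 * j by omega] at this
      rw [eq_div_iff (by positivity), mul_comm]
      exact_mod_cast (by rw [this]; congr 1; ring)
    have h3 : ∑ k ∈ Finset.range (n + 1), hypergeometricTerm n k *
        ((-1) ^ (n + j) * ((n + k).choose (n + j) : ℝ))
        = (-1) ^ (n + j) * ∑ k ∈ Finset.range (n + 1), hypergeometricTerm n k *
          ((n + k).choose (n + j) : ℝ) := by
      rw [Finset.mul_sum]
      exact Finset.sum_congr rfl fun _ _ => by ring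
    rw [nsmul_eq_mul, h2, h3, pow_add]
    ring
  · have h1 : ¬ 2 ∣ e + 2 * n := fun h => he ((Nat.dvd_add_left (Dvd.intro _ rfl)).1 h)
    simp [coeff_one_sub_X_sq_pow_of_odd _ he, coeff_one_sub_X_sq_pow_of_odd _ h1]

open Polynomial in
theorem iterate_derivative_one_sub_X_sq_pow (n : ℕ) :
    derivative^[2 * n] ((1 - X ^ 2 : ℝ[X]) ^ n) = (-1) ^ n * C ((2 * n)! : ℝ) := by
  ext e
  have hsgn : ((-1 : ℝ[X]) ^ n) = C ((-1) ^ n) := by simp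
  rw [coeff_iterate_derivative, hsgn, coeff_C_mul, coeff_C]
  by_cases he : 2 ∣ e
  · obtain ⟨j, rfl⟩ := he
    rw [show 2 * j + 2 * n = 2 * (n + j) by ring, coeff_one_sub_X_sq_pow_two_mul]
    rcases Nat.eq_zero_or_pos j with rfl | hj
    · simp [Nat.descFactorial_self, mul_comm]
    · rw [Nat.choose_eq_zero_of_lt (by omega), if_neg (by omega)]
      simp
  · have h1 : ¬ 2 ∣ e + 2 * n := fun h => he ((Nat.dvd_add_left (Dvd.intro _ rfl)).1 h)
    rw [coeff_one_sub_X_sq_pow_of_odd _ h1, if_neg (by rintro rfl; simp at he)]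
    simp

theorem integral_boggioKernel {n : ℕ} (hn : 1 ≤ n) {t : ℝ} (ht : t ∈ Ioo (-1 : ℝ) 1) :
    ∫ s, boggioKernel n t s ∂intervalMeasure = (1 - t ^ 2) ^ n / (2 * n)! := by
  have h0 : ((2 * n)! : ℝ) ≠ 0 := by positivity
  have h := integral_boggioKernel_mul_polynomial hn (dvd_refl _)
    (iterate_derivative_one_sub_X_sq_pow n) ht
  simp only [Polynomial.eval_C] at h
  rw [integral_mul_const] at h
  rw [eq_div_iff h0, h]
  simp

theorem integral_boggioKernel_mul_one_sub_sq_pow {n : ℕ} (hn : 1 ≤ n) {t : ℝ}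
    (ht : t ∈ Ioo (-1 : ℝ) 1) :
    ∫ s, boggioKernel n t s * (1 - s ^ 2) ^ n ∂intervalMeasure
      = greenConstant n * ∑ k ∈ Finset.range (n + 1),
        hypergeometricTerm n k * (1 - t ^ 2) ^ (n + k) := by
  have h := integral_boggioKernel_mul_polynomial hn
    (Dvd.dvd.mul_left (Finset.dvd_sum fun k _ => Dvd.dvd.mul_left (pow_dvd_pow _ (by omega)) _) _)
    (iterate_derivative_sum_one_sub_X_sq_pow hn) ht
  simpa [Polynomial.eval_finsetSum] using h

theorem one_sub_sq_mem {t : ℝ} (ht : t ∈ Ioo (-1 : ℝ) 1) : 0 < 1 - t ^ 2 ∧ 1 - t ^ 2 ≤ 1 := by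
  constructor <;> nlinarith [ht.1, ht.2, sq_nonneg t]

/-- As 0 < 1-t² ≤ 1 and the coefficients are positive, each power may be enlarged to the n-th; the
coefficients then sum to R_n. -/
theorem integral_boggioKernel_mul_one_sub_sq_pow_le {n : ℕ} (hn : 1 ≤ n) {t : ℝ}
    (ht : t ∈ Ioo (-1 : ℝ) 1) :
    ∫ s, boggioKernel n t s * (1 - s ^ 2) ^ n ∂intervalMeasure
      ≤ hypergeometricRatio n * greenConstant n * (1 - t ^ 2) ^ n := by
  obtain ⟨h0, h1⟩ := one_sub_sq_mem ht
  rw [integral_boggioKernel_mul_one_sub_sq_pow hn ht, mul_comm (hypergeometricRatio n), mul_assoc,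
    hypergeometricRatio_eq, Finset.sum_mul]
  refine mul_le_mul_of_nonneg_left (Finset.sum_le_sum fun k hk => ?_) (greenConstant_pos n).le
  refine mul_le_mul_of_nonneg_left (pow_le_pow_of_le_one h0.le h1 (by omega)) ?_
  exact (hypergeometricTerm_pos hn (Nat.lt_succ_iff.1 (Finset.mem_range.1 hk))).le

theorem hypergeometricTerm_zero (n : ℕ) : hypergeometricTerm n 0 = 1 := by
  simp [hypergeometricTerm]

/-- Only the term k = 0, with coefficient 1, is kept. -/
theorem le_integral_boggioKernel_mul_one_sub_sq_pow {n : ℕ} (hn : 1 ≤ n) {t : ℝ}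
    (ht : t ∈ Ioo (-1 : ℝ) 1) :
    greenConstant n * (1 - t ^ 2) ^ n
      ≤ ∫ s, boggioKernel n t s * (1 - s ^ 2) ^ n ∂intervalMeasure := by
  obtain ⟨h0, h1⟩ := one_sub_sq_mem ht
  rw [integral_boggioKernel_mul_one_sub_sq_pow hn ht]
  refine mul_le_mul_of_nonneg_left ?_ (greenConstant_pos n).le
  have h := Finset.single_le_sum
    (f := fun k => hypergeometricTerm n k * (1 - t ^ 2) ^ (n + k)) (s := Finset.range (n + 1))
    (fun k hk => mul_nonneg
      (hypergeometricTerm_pos hn (Nat.lt_succ_iff.1 (Finset.mem_range.1 hk))).le (by positivity))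
    (Finset.mem_range.2 (Nat.succ_pos n))
  simpa [hypergeometricTerm_zero] using h

/-! ### Limits of R_n, a_n and b_n -/

theorem tendsto_hypergeometricRatio :
    Filter.Tendsto hypergeometricRatio Filter.atTop (nhds 1) := by
  have hstep : ∀ n k : ℕ, hypergeometricTerm n (k + 1) = hypergeometricTerm n k *
      ((1 / 2 + k) / (n + 1 + k) * ((n - k) / (2 * n - 1 - k))) := by
    intro n k
    have h0 : (k ! : ℝ) ≠ 0 := by positivity
    have h2 : (k + 1 : ℝ) ≠ 0 := by positivity
    simp only [hypergeometricTerm, risingFactorial_succ, Nat.factorial_succ]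
    rw [show (1 - 2 * (n : ℝ) + k) = -(2 * n - 1 - k) by ring,
      show (-(n : ℝ) + k) = -(n - k) by ring]
    push_cast
    rw [show risingFactorial k (1 / 2) * (1 / 2 + (k : ℝ)) * (risingFactorial k 1 * (1 + k)) *
        (risingFactorial k (-n) * -((n : ℝ) - k))
        = (-(k + 1)) * ((risingFactorial k (1 / 2) * risingFactorial k 1 * risingFactorial k (-n)) *
        ((1 / 2 + k) * (n - k))) by ring,
      show risingFactorial k (1 - 2 * (n : ℝ)) * -(2 * n - 1 - k) *
        (risingFactorial k (n + 1) * (n + 1 + k)) * ((k + 1) * (k ! : ℝ))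
        = (-(k + 1)) * ((risingFactorial k (1 - 2 * n) * risingFactorial k (n + 1) * k !) *
        ((n + 1 + k) * (2 * n - 1 - k))) by ring,
      mul_div_mul_left _ _ (neg_ne_zero.2 h2), mul_div_mul_comm, mul_div_mul_comm (1 / 2 + (k : ℝ))]
  -- The first ratio contributes 1/(n+1) and each later one at most 2/3. Any uniform constant below
  -- 1 would do, since it makes the tail O(1/n).
  have hbound : ∀ n : ℕ, 2 ≤ n → ∀ k, k + 1 ≤ n →
      hypergeometricTerm n (k + 1) ≤ 1 / (n + 1) * (2 / 3) ^ k := by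
    intro n hn k
    have hn' : (2 : ℝ) ≤ n := by exact_mod_cast hn
    induction k with
    | zero =>
      intro _
      rw [hstep, hypergeometricTerm_zero]
      have h1 : ((n : ℝ) - (0 : ℕ)) / (2 * n - 1 - (0 : ℕ)) ≤ 1 := by
        rw [div_le_one (by push_cast; linarith)]; push_cast; linarith
      have h2 : (1 / 2 + ((0 : ℕ) : ℝ)) / (n + 1 + (0 : ℕ)) ≤ 1 / (n + 1) := by
        push_cast
        rw [add_zero, add_zero]
        gcongr
        norm_num
      rw [one_mul, pow_zero]
      exact mul_le_mul h2 h1 (div_nonneg (by push_cast; linarith) (by push_cast; linarith))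
        (by positivity)
    | succ k ih =>
      intro hk
      have hk' : (k : ℝ) + 1 + 1 ≤ n := by exact_mod_cast hk
      rw [hstep, pow_succ, ← mul_assoc (1 / ((n : ℝ) + 1))]
      push_cast
      have h1 : ((n : ℝ) - (k + 1)) / (2 * n - 1 - (k + 1)) ≤ 2 / 3 := by
        rw [div_le_div_iff₀ (by linarith) (by norm_num)]
        have : (0 : ℝ) ≤ k := by positivity
        linarith
      have h2 : (1 / 2 + ((k : ℝ) + 1)) / (n + 1 + (k + 1)) ≤ 1 := by
        rw [div_le_one (by positivity)]; linarith
      have h3 : 0 ≤ ((n : ℝ) - (k + 1)) / (2 * n - 1 - (k + 1)) :=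
        div_nonneg (by linarith) (by linarith)
      refine mul_le_mul (ih (by omega)) ?_ (by positivity) (by positivity)
      calc _ ≤ 1 * (2 / 3 : ℝ) := mul_le_mul h2 h1 h3 zero_le_one
        _ = 2 / 3 := one_mul _
  have hgeom : ∀ m : ℕ, ∑ k ∈ Finset.range m, (2 / 3 : ℝ) ^ k ≤ 3 := by
    intro m
    rw [geom_sum_eq (by norm_num)]
    have : (0 : ℝ) ≤ (2 / 3) ^ m := by positivity
    rw [div_le_iff_of_neg (by norm_num)]
    linarith
  have hlim : Filter.Tendsto (fun n : ℕ => 1 + 3 * (1 / ((n : ℝ) + 1))) Filter.atTop (nhds 1) := by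
    simpa using (tendsto_one_div_add_atTop_nhds_zero_nat (𝕜 := ℝ)).const_mul 3 |>.const_add 1
  refine tendsto_of_tendsto_of_tendsto_of_le_of_le' tendsto_const_nhds hlim ?_ ?_
  · filter_upwards [Filter.eventually_ge_atTop 1] with n hn
    rw [hypergeometricRatio_eq, ← hypergeometricTerm_zero n]
    exact Finset.single_le_sum (f := fun k => hypergeometricTerm n k)
      (fun k hk => (hypergeometricTerm_pos hn (Nat.lt_succ_iff.1 (Finset.mem_range.1 hk))).le)
      (Finset.mem_range.2 (Nat.succ_pos n))
  · filter_upwards [Filter.eventually_ge_atTop 2] with n hn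
    rw [hypergeometricRatio_eq, Finset.sum_range_succ', hypergeometricTerm_zero, add_comm]
    refine add_le_add_right ?_ 1
    calc _ ≤ ∑ k ∈ Finset.range n, 1 / ((n : ℝ) + 1) * (2 / 3) ^ k :=
          Finset.sum_le_sum fun k hk => hbound n hn k (Finset.mem_range.1 hk)
      _ = 1 / ((n : ℝ) + 1) * ∑ k ∈ Finset.range n, (2 / 3 : ℝ) ^ k := by rw [Finset.mul_sum]
      _ ≤ 1 / ((n : ℝ) + 1) * 3 := mul_le_mul_of_nonneg_left (hgeom n) (by positivity)
      _ = _ := mul_comm _ _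

/-- The Wallis ratio `Γ(n+1/2)/Γ(n+1)`. -/
noncomputable def wallisRatio (n : ℕ) : ℝ := Real.Gamma (n + 1 / 2) / Real.Gamma (n + 1)

/-- Log-convexity gives Γ(x+1/2)² ≤ Γ(x)Γ(x+1); x = n yields the upper bound and x = n+1/2 the lower
one. -/
theorem wallisRatio_sq_bounds {n : ℕ} (hn : 1 ≤ n) :
    1 / (n + 1 / 2 : ℝ) ≤ wallisRatio n ^ 2 ∧ wallisRatio n ^ 2 ≤ 1 / (n : ℝ) := by
  have hn' : (0 : ℝ) < n := by exact_mod_cast hn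
  have key : ∀ x : ℝ, 0 < x → Real.Gamma (x + 1 / 2) ^ 2 ≤ Real.Gamma x * Real.Gamma (x + 1) := by
    intro x hx
    have h := Real.Gamma_mul_add_mul_le_rpow_Gamma_mul_rpow_Gamma (s := x) (t := x + 1)
      (a := 1 / 2) (b := 1 / 2) hx (by positivity) (by norm_num) (by norm_num) (by norm_num)
    rw [show 1 / 2 * x + 1 / 2 * (x + 1) = x + 1 / 2 by ring, ← Real.sqrt_eq_rpow,
      ← Real.sqrt_eq_rpow, ← Real.sqrt_mul (Real.Gamma_pos_of_pos hx).le] at h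
    calc _ ≤ √(Real.Gamma x * Real.Gamma (x + 1)) ^ 2 :=
          pow_le_pow_left₀ (Real.Gamma_pos_of_pos (by positivity)).le h 2
      _ = _ := Real.sq_sqrt (mul_pos (Real.Gamma_pos_of_pos hx)
          (Real.Gamma_pos_of_pos (by positivity))).le
  have hG : 0 < Real.Gamma (n + 1 : ℝ) := Real.Gamma_pos_of_pos (by positivity)
  have h1 := key n hn'
  have h2 := key (n + 1 / 2) (by positivity)
  rw [show (n : ℝ) + 1 / 2 + 1 / 2 = n + 1 by ring, Real.Gamma_add_one (s := (n : ℝ) + 1 / 2) (by positivity)] at h2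
  have h3 : Real.Gamma (n + 1 : ℝ) = n * Real.Gamma n := Real.Gamma_add_one hn'.ne'
  rw [wallisRatio, div_pow]
  constructor
  · rw [div_le_div_iff₀ (by positivity) (by positivity)]
    linarith
  · rw [div_le_div_iff₀ (by positivity) (by positivity)]
    calc _ ≤ (Real.Gamma n * Real.Gamma (n + 1)) * n := mul_le_mul_of_nonneg_right h1 hn'.le
      _ = _ := by rw [h3]; ring

/-- Reading (2n)! as Γ(2n+1) exhibits a_n as a quotient of Wallis ratios at n and 2n. These behave
like n^(-1/2) and (2n)^(-1/2), whence the limit 1. -/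
theorem lowerFactor_sq (n : ℕ) :
    lowerFactor n ^ 2 = wallisRatio n ^ 2 / (2 * wallisRatio (2 * n) ^ 2) := by
  have h1 : Real.Gamma (2 * n + 1 : ℝ) = (2 * n)! := by
    rw [← Real.Gamma_nat_eq_factorial]; push_cast; rfl
  have h2 : (Real.Gamma (2 * n + 1 / 2 : ℝ)) ≠ 0 := (Real.Gamma_pos_of_pos (by positivity)).ne'
  have h3 : (Real.Gamma (n + 1 : ℝ)) ≠ 0 := (Real.Gamma_pos_of_pos (by positivity)).ne'
  have h4 : ((2 * n)! : ℝ) ≠ 0 := by positivity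
  rw [lowerFactor, wallisRatio, wallisRatio]
  push_cast
  rw [h1]
  have h5 : √2 ^ 2 = (2 : ℝ) := Real.sq_sqrt (by norm_num)
  field_simp
  rw [h5]

theorem lowerFactor_pos (n : ℕ) : 0 < lowerFactor n := by
  rw [lowerFactor_eq]
  have := greenConstant_pos n
  positivity

theorem lowerFactor_sq_bounds {n : ℕ} (hn : 1 ≤ n) :
    n / (n + 1 / 2 : ℝ) ≤ lowerFactor n ^ 2 ∧ lowerFactor n ^ 2 ≤ 1 + 1 / (4 * n : ℝ) := by
  have hn' : (0 : ℝ) < n := by exact_mod_cast hn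
  obtain ⟨h1, h2⟩ := wallisRatio_sq_bounds hn
  obtain ⟨h3, h4⟩ := wallisRatio_sq_bounds (n := 2 * n) (by omega)
  push_cast at h3 h4
  have h5 : 0 < wallisRatio (2 * n) ^ 2 := lt_of_lt_of_le (by positivity) h3
  rw [lowerFactor_sq]
  constructor
  · calc (n / (n + 1 / 2 : ℝ)) = 1 / (n + 1 / 2 : ℝ) / (2 * (1 / (2 * n))) := by field_simp
      _ ≤ _ := div_le_div₀ (by positivity) h1 (by positivity) (by linarith)
  · calc _ ≤ 1 / (n : ℝ) / (2 * (1 / (2 * n + 1 / 2))) :=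
          div_le_div₀ (by positivity) h2 (by positivity) (by linarith)
      _ = _ := by field_simp; ring

theorem tendsto_lowerFactor : Filter.Tendsto lowerFactor Filter.atTop (nhds 1) := by
  have h1 : Filter.Tendsto (fun n : ℕ => (n : ℝ) / (n + 1 / 2)) Filter.atTop (nhds 1) := by
    exact tendsto_natCast_div_add_atTop (1 / 2 : ℝ)
  have h2 : Filter.Tendsto (fun n : ℕ => 1 + 1 / (4 * n : ℝ)) Filter.atTop (nhds 1) := by
    have := (tendsto_one_div_atTop_nhds_zero_nat (𝕜 := ℝ)).const_mul (1 / 4) |>.const_add 1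
    simp only [mul_zero, add_zero] at this
    refine this.congr fun n => ?_
    rw [one_div_mul_one_div]
  have h3 : Filter.Tendsto (fun n => lowerFactor n ^ 2) Filter.atTop (nhds 1) := by
    refine tendsto_of_tendsto_of_tendsto_of_le_of_le' h1 h2 ?_ ?_
    · filter_upwards [Filter.eventually_ge_atTop 1] with n hn using (lowerFactor_sq_bounds hn).1
    · filter_upwards [Filter.eventually_ge_atTop 1] with n hn using (lowerFactor_sq_bounds hn).2
  have h4 := h3.sqrt
  rw [Real.sqrt_one] at h4
  exact h4.congr fun n => Real.sqrt_sq (lowerFactor_pos n).le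

theorem tendsto_upperFactor : Filter.Tendsto upperFactor Filter.atTop (nhds 1) := by
  have h := tendsto_hypergeometricRatio.mul tendsto_lowerFactor
  rw [one_mul] at h
  exact h

/-! ### Schur's test and interpolation -/

/-- Schur's test for a nonnegative kernel. -/
theorem lintegral_rpow_lintegral_le_of_schur {α : Type*} [MeasurableSpace α] {μ : Measure α}
    [SFinite μ] {k : α → α → ℝ≥0∞} (hk : Measurable (Function.uncurry k)) {p q : ℝ}
    (hpq : p.HolderConjugate q) {h : α → ℝ≥0∞} (hh : Measurable h) (h0 : ∀ᵐ x ∂μ, h x ≠ 0)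
    (htop : ∀ᵐ x ∂μ, h x ≠ ⊤) {A B : ℝ≥0∞}
    (hA : ∀ᵐ t ∂μ, ∫⁻ s, k t s * h s ^ q ∂μ ≤ A * h t ^ q)
    (hB : ∀ᵐ s ∂μ, ∫⁻ t, k t s * h t ^ p ∂μ ≤ B * h s ^ p) {f : α → ℝ≥0∞}
    (hf : AEMeasurable f μ) :
    ∫⁻ t, (∫⁻ s, k t s * f s ∂μ) ^ p ∂μ ≤ A ^ (p / q) * B * ∫⁻ s, f s ^ p ∂μ := by
  have hp := hpq.pos
  have hq := hpq.symm.pos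
  have hkt : ∀ t, Measurable (k t) := fun t => hk.comp measurable_prodMk_left
  have hks : ∀ s, Measurable (fun t => k t s) := fun s => hk.comp measurable_prodMk_right
  set g : α → ℝ≥0∞ := fun s => f s ^ p * ((h s)⁻¹) ^ p with hg
  have hgm : AEMeasurable g μ := (hf.pow_const p).mul (hh.inv.pow_const p).aemeasurable
  have hpoint : ∀ᵐ t ∂μ, (∫⁻ s, k t s * f s ∂μ) ^ p
      ≤ A ^ (p / q) * ∫⁻ s, h t ^ p * (k t s * g s) ∂μ := by
    filter_upwards [hA] with t ht
    -- The kernel is split as k^(1/p) k^(1/q) and the weight inserted as h⁻¹h, so that Hölder leaves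
    -- k (f/h)^p and k h^q.
    have h1 : ∫⁻ s, k t s * f s ∂μ
        = ∫⁻ s, ((fun s => k t s ^ (1 / p) * (f s * (h s)⁻¹)) *
            (fun s => k t s ^ (1 / q) * h s)) s ∂μ := by
      refine lintegral_congr_ae ?_
      filter_upwards [h0, htop] with s hs0 hs1
      have h2 : k t s ^ (1 / p) * k t s ^ (1 / q) = k t s := by
        rw [← ENNReal.rpow_add_of_nonneg _ _ (by positivity) (by positivity), one_div, one_div,
          hpq.inv_add_inv_eq_one, ENNReal.rpow_one]
      simp only [Pi.mul_apply]
      calc k t s * f s = (k t s ^ (1 / p) * k t s ^ (1 / q)) * f s * ((h s)⁻¹ * h s) := by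
            rw [h2, ENNReal.inv_mul_cancel hs0 hs1, mul_one]
        _ = _ := by ring
    have h2 := ENNReal.lintegral_mul_le_Lp_mul_Lq μ hpq
      (f := fun s => k t s ^ (1 / p) * (f s * (h s)⁻¹)) (g := fun s => k t s ^ (1 / q) * h s)
      (((hkt t).pow_const _).aemeasurable.mul (hf.mul hh.inv.aemeasurable))
      (((hkt t).pow_const _).mul hh).aemeasurable
    have h3 : ∀ s, (k t s ^ (1 / p) * (f s * (h s)⁻¹)) ^ p = k t s * g s := fun s => by
      rw [ENNReal.mul_rpow_of_nonneg _ _ hp.le, ENNReal.mul_rpow_of_nonneg _ _ hp.le,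
        ← ENNReal.rpow_mul, one_div_mul_cancel hp.ne', ENNReal.rpow_one]
    have h4 : ∀ s, (k t s ^ (1 / q) * h s) ^ q = k t s * h s ^ q := fun s => by
      rw [ENNReal.mul_rpow_of_nonneg _ _ hq.le, ← ENNReal.rpow_mul, one_div_mul_cancel hq.ne',
        ENNReal.rpow_one]
    simp only [h3, h4] at h2
    rw [h1]
    calc _ ≤ ((∫⁻ s, k t s * g s ∂μ) ^ (1 / p) * (∫⁻ s, k t s * h s ^ q ∂μ) ^ (1 / q)) ^ p :=
          ENNReal.rpow_le_rpow h2 hp.le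
      _ = (∫⁻ s, k t s * g s ∂μ) * (∫⁻ s, k t s * h s ^ q ∂μ) ^ (p / q) := by
          rw [ENNReal.mul_rpow_of_nonneg _ _ hp.le, ← ENNReal.rpow_mul, ← ENNReal.rpow_mul,
            one_div_mul_cancel hp.ne', ENNReal.rpow_one, one_div_mul_eq_div]
      _ ≤ (∫⁻ s, k t s * g s ∂μ) * (A * h t ^ q) ^ (p / q) := by gcongr
      _ = (∫⁻ s, k t s * g s ∂μ) * (A ^ (p / q) * h t ^ p) := by
          rw [ENNReal.mul_rpow_of_nonneg _ _ (by positivity), ← ENNReal.rpow_mul,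
            mul_div_cancel₀ _ hq.ne']
      _ = A ^ (p / q) * (h t ^ p * ∫⁻ s, k t s * g s ∂μ) := by ring
      _ = _ := by
          congr 1
          exact (lintegral_const_mul'' _ ((hkt t).aemeasurable.mul hgm)).symm
  have hjoint : AEMeasurable (Function.uncurry fun t s => h t ^ p * (k t s * g s)) (μ.prod μ) :=
    ((hh.comp measurable_fst).pow_const p).aemeasurable.mul (hk.aemeasurable.mul hgm.comp_snd)
  calc _ ≤ ∫⁻ t, A ^ (p / q) * ∫⁻ s, h t ^ p * (k t s * g s) ∂μ ∂μ := lintegral_mono_ae hpoint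
    _ = A ^ (p / q) * ∫⁻ t, ∫⁻ s, h t ^ p * (k t s * g s) ∂μ ∂μ :=
        lintegral_const_mul'' _ hjoint.lintegral_prod_right'
    _ = A ^ (p / q) * ∫⁻ s, ∫⁻ t, h t ^ p * (k t s * g s) ∂μ ∂μ := by
        rw [lintegral_lintegral_swap hjoint]
    _ ≤ A ^ (p / q) * ∫⁻ s, B * f s ^ p ∂μ := by
        refine mul_le_mul_right (lintegral_mono_ae ?_) _
        filter_upwards [hB, h0, htop] with s hs hs0 hs1
        have h5 : ∀ t, h t ^ p * (k t s * g s) = (k t s * h t ^ p) * g s := fun t => by ring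
        simp only [h5]
        have h6 : ∫⁻ t, k t s * h t ^ p * g s ∂μ = (∫⁻ t, k t s * h t ^ p ∂μ) * g s :=
          lintegral_mul_const _ ((hks s).mul (hh.pow_const p))
        rw [h6]
        calc _ ≤ B * h s ^ p * g s := by gcongr
          _ = B * f s ^ p * (h s * (h s)⁻¹) ^ p := by
              rw [hg, ENNReal.mul_rpow_of_nonneg _ _ hp.le]; ring
          _ = _ := by rw [ENNReal.mul_inv_cancel hs0 hs1, ENNReal.one_rpow, mul_one]
    _ = _ := by rw [lintegral_const_mul'' _ (hf.pow_const p), mul_assoc]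

/-- Hölder applied to k w^θ = (k w)^θ k^(1-θ). -/
theorem lintegral_mul_rpow_le_of_le {α : Type*} [MeasurableSpace α] {μ : Measure α}
    {k w : α → ℝ≥0∞} (hk : Measurable k) (hw : Measurable w) {M N : ℝ≥0∞}
    (hM : ∫⁻ s, k s ∂μ ≤ M) (hN : ∫⁻ s, k s * w s ∂μ ≤ N) {θ : ℝ} (h0 : 0 ≤ θ) (h1 : θ ≤ 1) :
    ∫⁻ s, k s * w s ^ θ ∂μ ≤ N ^ θ * M ^ (1 - θ) := by
  have h1' : 0 ≤ 1 - θ := by linarith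
  have h := ENNReal.lintegral_mul_norm_pow_le (μ := μ) (f := fun s => k s * w s) (g := k)
    (hk.mul hw).aemeasurable hk.aemeasurable h0 h1' (by ring)
  refine le_trans (le_of_eq (lintegral_congr fun s => ?_)) (h.trans (by gcongr))
  rw [ENNReal.mul_rpow_of_nonneg _ _ h0, mul_right_comm,
    ← ENNReal.rpow_add_of_nonneg _ _ h0 h1', add_sub_cancel, ENNReal.rpow_one]

/-! ### Upper bounds for the solution operator -/

instance isFiniteMeasure_intervalMeasure : IsFiniteMeasure intervalMeasure :=
  ⟨by simp [intervalMeasure]⟩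

theorem ae_intervalMeasure {P : ℝ → Prop} (h : ∀ t ∈ Ioo (-1 : ℝ) 1, P t) :
    ∀ᵐ t ∂intervalMeasure, P t :=
  (ae_restrict_mem measurableSet_Ioo).mono h

theorem Continuous.integrable_intervalMeasure {E : Type*} [NormedAddCommGroup E] {f : ℝ → E}
    (hf : Continuous f) : Integrable f intervalMeasure :=
  (hf.integrableOn_Icc (a := -1) (b := 1)).mono_set Ioo_subset_Icc_self

theorem continuous_boggioKernel_right (n : ℕ) (t : ℝ) : Continuous (boggioKernel n t) := by
  have h := (continuous_boggioKernel n).comp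
    (Continuous.prodMk (continuous_const (y := t)) continuous_id)
  exact h

/-- The kernel `boggioKernel` with values in `ℝ≥0∞`. -/
noncomputable def ennrealKernel (n : ℕ) (t s : ℝ) : ℝ≥0∞ := ENNReal.ofReal (boggioKernel n t s)

theorem ennrealKernel_comm (n : ℕ) (t s : ℝ) : ennrealKernel n t s = ennrealKernel n s t := by
  rw [ennrealKernel, ennrealKernel, boggioKernel_comm]

theorem measurable_ennrealKernel (n : ℕ) : Measurable (Function.uncurry (ennrealKernel n)) :=
  (continuous_boggioKernel n).measurable.ennreal_ofReal

theorem measurable_ennrealKernel_right (n : ℕ) (t : ℝ) : Measurable (ennrealKernel n t) :=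
  (continuous_boggioKernel_right n t).measurable.ennreal_ofReal

theorem lintegral_ennrealKernel_mul {n : ℕ} {t : ℝ} (ht : t ∈ Ioo (-1 : ℝ) 1) {g : ℝ → ℝ}
    (hg : ∀ s ∈ Ioo (-1 : ℝ) 1, 0 ≤ g s)
    (hi : Integrable (fun s => boggioKernel n t s * g s) intervalMeasure) :
    ∫⁻ s, ennrealKernel n t s * ENNReal.ofReal (g s) ∂intervalMeasure
      = ENNReal.ofReal (∫ s, boggioKernel n t s * g s ∂intervalMeasure) := by
  rw [ofReal_integral_eq_lintegral_ofReal hi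
    (ae_intervalMeasure fun s hs => mul_nonneg (boggioKernel_nonneg n ht hs) (hg s hs))]
  refine lintegral_congr_ae (ae_intervalMeasure fun s hs => ?_)
  simp only
  rw [ennrealKernel, ENNReal.ofReal_mul (boggioKernel_nonneg n ht hs)]

theorem lintegral_ennrealKernel {n : ℕ} (hn : 1 ≤ n) {t : ℝ} (ht : t ∈ Ioo (-1 : ℝ) 1) :
    ∫⁻ s, ennrealKernel n t s ∂intervalMeasure = ENNReal.ofReal ((1 - t ^ 2) ^ n / (2 * n)!) := by
  have := lintegral_ennrealKernel_mul (n := n) ht (g := fun _ => 1) (fun _ _ => zero_le_one)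
    (((continuous_boggioKernel_right n t).mul continuous_const).integrable_intervalMeasure)
  simpa [integral_boggioKernel hn ht] using this

theorem lintegral_ennrealKernel_le {n : ℕ} (hn : 1 ≤ n) {t : ℝ} (ht : t ∈ Ioo (-1 : ℝ) 1) :
    ∫⁻ s, ennrealKernel n t s ∂intervalMeasure ≤ ENNReal.ofReal (1 / (2 * n)!) := by
  obtain ⟨h0, h1⟩ := one_sub_sq_mem ht
  rw [lintegral_ennrealKernel hn ht]
  exact ENNReal.ofReal_le_ofReal (by gcongr; exact pow_le_one₀ h0.le h1)

theorem lintegral_ennrealKernel_mul_weight_le {n : ℕ} (hn : 1 ≤ n) {t : ℝ}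
    (ht : t ∈ Ioo (-1 : ℝ) 1) :
    ∫⁻ s, ennrealKernel n t s * ENNReal.ofReal ((1 - s ^ 2) ^ n) ∂intervalMeasure
      ≤ ENNReal.ofReal (hypergeometricRatio n * greenConstant n) *
        ENNReal.ofReal ((1 - t ^ 2) ^ n) := by
  rw [lintegral_ennrealKernel_mul ht (fun s hs => pow_nonneg (one_sub_sq_mem hs).1.le _)
    (((continuous_boggioKernel_right n t).mul (by fun_prop)).integrable_intervalMeasure),
    ← ENNReal.ofReal_mul' (pow_nonneg (one_sub_sq_mem ht).1.le _)]
  exact ENNReal.ofReal_le_ofReal (integral_boggioKernel_mul_one_sub_sq_pow_le hn ht)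

section Operator

variable {𝕜 : Type*} [RCLike 𝕜]

theorem solutionOperator_eq {n : ℕ} (hn : 1 ≤ n) (f : ℝ → 𝕜) {t : ℝ} (ht : t ∈ Ioo (-1 : ℝ) 1) :
    solutionOperator n f t = ∫ s, (boggioKernel n t s : 𝕜) * f s ∂intervalMeasure := by
  refine integral_congr_ae (ae_intervalMeasure fun s hs => ?_)
  simp only
  rw [greenFunction_eq_boggioKernel hn ht hs]

theorem aestronglyMeasurable_solutionOperator {n : ℕ} (hn : 1 ≤ n) {f : ℝ → 𝕜}
    (hf : AEStronglyMeasurable f intervalMeasure) :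
    AEStronglyMeasurable (solutionOperator n f) intervalMeasure := by
  have h1 : AEStronglyMeasurable (fun z : ℝ × ℝ => (boggioKernel n z.1 z.2 : 𝕜) * f z.2)
      (intervalMeasure.prod intervalMeasure) :=
    (RCLike.continuous_ofReal.comp (continuous_boggioKernel n)).aestronglyMeasurable.mul hf.comp_snd
  exact h1.integral_prod_right'.congr
    (ae_intervalMeasure fun t ht => (solutionOperator_eq hn f ht).symm)

theorem enorm_solutionOperator_le {n : ℕ} (hn : 1 ≤ n) (f : ℝ → 𝕜) {t : ℝ}
    (ht : t ∈ Ioo (-1 : ℝ) 1) :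
    ‖solutionOperator n f t‖ₑ ≤ ∫⁻ s, ennrealKernel n t s * ‖f s‖ₑ ∂intervalMeasure := by
  rw [solutionOperator_eq hn f ht]
  refine (enorm_integral_le_lintegral_enorm _).trans (lintegral_mono_ae
    (ae_intervalMeasure fun s hs => ?_))
  rw [enorm_mul, ennrealKernel, ← ofReal_norm (boggioKernel n t s : 𝕜), RCLike.norm_ofReal,
    abs_of_nonneg (boggioKernel_nonneg n ht hs)]

theorem enorm_solutionOperator_ofReal {n : ℕ} (hn : 1 ≤ n) {g : ℝ → ℝ}
    (hg : ∀ s ∈ Ioo (-1 : ℝ) 1, 0 ≤ g s) {t : ℝ} (ht : t ∈ Ioo (-1 : ℝ) 1) :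
    ‖solutionOperator n (fun s => (g s : 𝕜)) t‖ₑ
      = ENNReal.ofReal (∫ s, boggioKernel n t s * g s ∂intervalMeasure) := by
  rw [solutionOperator_eq hn _ ht]
  have h1 : ∫ s, (boggioKernel n t s : 𝕜) * (g s : 𝕜) ∂intervalMeasure
      = ((∫ s, boggioKernel n t s * g s ∂intervalMeasure : ℝ) : 𝕜) := by
    rw [← integral_ofReal]
    simp only [RCLike.ofReal_mul]
  rw [h1, ← ofReal_norm, RCLike.norm_ofReal, abs_of_nonneg]
  exact integral_nonneg_of_ae
    (ae_intervalMeasure fun s hs => mul_nonneg (boggioKernel_nonneg n ht hs) (hg s hs))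

theorem eLpNorm_top_solutionOperator_le {n : ℕ} (hn : 1 ≤ n) (f : ℝ → 𝕜) :
    eLpNorm (solutionOperator n f) ∞ intervalMeasure
      ≤ ENNReal.ofReal (1 / (2 * n)!) * eLpNorm f ∞ intervalMeasure := by
  simp only [eLpNorm_exponent_top]
  refine eLpNormEssSup_le_of_ae_enorm_bound (ae_intervalMeasure fun t ht => ?_)
  calc _ ≤ ∫⁻ s, ennrealKernel n t s * ‖f s‖ₑ ∂intervalMeasure := enorm_solutionOperator_le hn f ht
    _ ≤ ∫⁻ s, ennrealKernel n t s * eLpNormEssSup f intervalMeasure ∂intervalMeasure := by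
        refine lintegral_mono_ae ?_
        filter_upwards [enorm_ae_le_eLpNormEssSup f intervalMeasure] with s hs
        gcongr
    _ = (∫⁻ s, ennrealKernel n t s ∂intervalMeasure) * eLpNormEssSup f intervalMeasure :=
        lintegral_mul_const _ (measurable_ennrealKernel_right n t)
    _ ≤ _ := by gcongr; exact lintegral_ennrealKernel_le hn ht

/-- Tonelli and symmetry: for nonnegative g the integral of T_n g is that of (T_n 1) g, so L^1
estimates need only the evaluation of T_n 1. -/
theorem lintegral_lintegral_ennrealKernel_mul (n : ℕ) {g : ℝ → ℝ≥0∞}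
    (hg : AEMeasurable g intervalMeasure) :
    ∫⁻ t, ∫⁻ s, ennrealKernel n t s * g s ∂intervalMeasure ∂intervalMeasure
      = ∫⁻ s, (∫⁻ t, ennrealKernel n s t ∂intervalMeasure) * g s ∂intervalMeasure := by
  rw [lintegral_lintegral_swap ((measurable_ennrealKernel n).aemeasurable.mul hg.comp_snd)]
  refine lintegral_congr fun s => ?_
  simp only [fun t => ennrealKernel_comm n t s]
  exact lintegral_mul_const _ (measurable_ennrealKernel_right n s)

theorem eLpNorm_one_solutionOperator_le {n : ℕ} (hn : 1 ≤ n) {f : ℝ → 𝕜}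
    (hf : AEStronglyMeasurable f intervalMeasure) :
    eLpNorm (solutionOperator n f) 1 intervalMeasure
      ≤ ENNReal.ofReal (1 / (2 * n)!) * eLpNorm f 1 intervalMeasure := by
  simp only [eLpNorm_one_eq_lintegral_enorm]
  calc _ ≤ ∫⁻ t, ∫⁻ s, ennrealKernel n t s * ‖f s‖ₑ ∂intervalMeasure ∂intervalMeasure :=
        lintegral_mono_ae (ae_intervalMeasure fun t ht => enorm_solutionOperator_le hn f ht)
    _ = ∫⁻ s, (∫⁻ t, ennrealKernel n s t ∂intervalMeasure) * ‖f s‖ₑ ∂intervalMeasure :=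
        lintegral_lintegral_ennrealKernel_mul n hf.enorm
    _ ≤ ∫⁻ s, ENNReal.ofReal (1 / (2 * n)!) * ‖f s‖ₑ ∂intervalMeasure :=
        lintegral_mono_ae (ae_intervalMeasure fun s hs => by
          gcongr; exact lintegral_ennrealKernel_le hn hs)
    _ = _ := lintegral_const_mul'' _ hf.enorm

theorem eLpNorm_solutionOperator_le_of_schur {n : ℕ} (hn : 1 ≤ n) {p : ℝ≥0∞} (hp1 : p ≠ 0)
    (hp2 : p ≠ ∞) {q : ℝ} (hpq : p.toReal.HolderConjugate q) {h : ℝ → ℝ≥0∞} (hh : Measurable h)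
    (h0 : ∀ t ∈ Ioo (-1 : ℝ) 1, h t ≠ 0) (htop : ∀ t ∈ Ioo (-1 : ℝ) 1, h t ≠ ⊤) {A B D : ℝ≥0∞}
    (hA : ∀ t ∈ Ioo (-1 : ℝ) 1, ∫⁻ s, ennrealKernel n t s * h s ^ q ∂intervalMeasure
      ≤ A * h t ^ q)
    (hB : ∀ t ∈ Ioo (-1 : ℝ) 1, ∫⁻ s, ennrealKernel n t s * h s ^ p.toReal ∂intervalMeasure
      ≤ B * h t ^ p.toReal)
    (hD : A ^ (p.toReal / q) * B ≤ D ^ p.toReal) {f : ℝ → 𝕜}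
    (hf : AEStronglyMeasurable f intervalMeasure) :
    eLpNorm (solutionOperator n f) p intervalMeasure ≤ D * eLpNorm f p intervalMeasure := by
  have hpos := hpq.pos
  have h1 := lintegral_rpow_lintegral_le_of_schur (measurable_ennrealKernel n) hpq hh
    (ae_intervalMeasure h0) (ae_intervalMeasure htop) (ae_intervalMeasure hA)
    (ae_intervalMeasure fun t ht => by
      simp only [fun s => ennrealKernel_comm n s t]; exact hB t ht) hf.enorm
  rw [eLpNorm_eq_lintegral_rpow_enorm_toReal hp1 hp2, eLpNorm_eq_lintegral_rpow_enorm_toReal hp1 hp2]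
  calc _ ≤ (D ^ p.toReal * ∫⁻ s, ‖f s‖ₑ ^ p.toReal ∂intervalMeasure) ^ (1 / p.toReal) := by
        refine ENNReal.rpow_le_rpow ?_ (by positivity)
        refine le_trans (lintegral_mono_ae (ae_intervalMeasure fun t ht => ?_)) (h1.trans ?_)
        · exact ENNReal.rpow_le_rpow (enorm_solutionOperator_le hn f ht) hpos.le
        · gcongr
    _ = _ := by
        rw [ENNReal.mul_rpow_of_nonneg _ _ (by positivity), ← ENNReal.rpow_mul,
          mul_one_div_cancel hpos.ne', ENNReal.rpow_one]

theorem eLpNorm_solutionOperator_le {n : ℕ} (hn : 1 ≤ n) {p : ℝ≥0∞} (hp : 1 ≤ p) {f : ℝ → 𝕜}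
    (hf : AEStronglyMeasurable f intervalMeasure) :
    eLpNorm (solutionOperator n f) p intervalMeasure
      ≤ ENNReal.ofReal (1 / (2 * n)!) * eLpNorm f p intervalMeasure := by
  rcases eq_or_ne p ∞ with rfl | hp2
  · exact eLpNorm_top_solutionOperator_le hn f
  rcases hp.eq_or_lt with rfl | hp1
  · exact eLpNorm_one_solutionOperator_le hn hf
  have h1 : 1 < p.toReal := by
    have := (ENNReal.toReal_lt_toReal ENNReal.one_ne_top hp2).2 hp1
    simpa using this
  have hpq := Real.HolderConjugate.conjExponent h1
  have hM : ENNReal.ofReal (1 / (2 * n)!) ≠ 0 := by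
    rw [Ne, ENNReal.ofReal_eq_zero, not_le]; positivity
  -- Schur's test with constant weight; M^(p/q) M = M^p because p/q = p-1.
  refine eLpNorm_solutionOperator_le_of_schur hn (by positivity) hp2 hpq (h := fun _ => 1)
    measurable_const (fun _ _ => one_ne_zero) (fun _ _ => ENNReal.one_ne_top)
    (A := ENNReal.ofReal (1 / (2 * n)!)) (B := ENNReal.ofReal (1 / (2 * n)!)) ?_ ?_ ?_ hf
  · intro t ht
    simpa using lintegral_ennrealKernel_le hn ht
  · intro t ht
    simpa using lintegral_ennrealKernel_le hn ht
  · nth_rewrite 2 [← ENNReal.rpow_one (ENNReal.ofReal (1 / (2 * n)!))]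
    rw [← ENNReal.rpow_add _ _ hM ENNReal.ofReal_ne_top, hpq.div_conj_eq_sub_one, sub_add_cancel]

theorem memLp_solutionOperator {n : ℕ} (hn : 1 ≤ n) {p : ℝ≥0∞} (hp : 1 ≤ p) {f : ℝ → 𝕜}
    (hf : MemLp f p intervalMeasure) : MemLp (solutionOperator n f) p intervalMeasure :=
  ⟨aestronglyMeasurable_solutionOperator hn hf.1,
    (eLpNorm_solutionOperator_le hn hp hf.1).trans_lt
      (ENNReal.mul_lt_top ENNReal.ofReal_lt_top hf.2)⟩

/-- The Schur weight is w^(1/r). Its p-th and q-th powers are w^(p/r) and w^(q/r), whose exponents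
lie in (0,1] since r dominates both, so both integrals are controlled by interpolating T_n 1 ≤ M and
T_n w ≤ β w. -/
theorem eLpNorm_solutionOperator_le_interpolated {n : ℕ} (hn : 1 ≤ n) {p : ℝ≥0∞} (hp1 : p ≠ 0)
    (hp2 : p ≠ ∞) {q r : ℝ} (hpq : p.toReal.HolderConjugate q) (hpr : p.toReal ≤ r) (hqr : q ≤ r)
    {f : ℝ → 𝕜} (hf : AEStronglyMeasurable f intervalMeasure) :
    eLpNorm (solutionOperator n f) p intervalMeasure
      ≤ ENNReal.ofReal (hypergeometricRatio n * greenConstant n) ^ (2 / r) *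
        ENNReal.ofReal (1 / (2 * n)!) ^ (1 - 2 / r) * eLpNorm f p intervalMeasure := by
  set β := ENNReal.ofReal (hypergeometricRatio n * greenConstant n) with hβ
  set M := ENNReal.ofReal (1 / (2 * n)!) with hM
  have hP := hpq.pos
  have hQ := hpq.symm.pos
  have hr : 0 < r := hP.trans_le hpr
  have hM0 : M ≠ 0 := by
    rw [hM, Ne, ENNReal.ofReal_eq_zero, not_le]; positivity
  have hβ0 : β ≠ 0 := by
    rw [hβ, Ne, ENNReal.ofReal_eq_zero, not_le]
    refine mul_pos ?_ (greenConstant_pos n)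
    exact Finset.sum_pos (fun k hk =>
      hypergeometricTerm_pos hn (Nat.lt_succ_iff.1 (Finset.mem_range.1 hk)))
      ⟨0, Finset.mem_range.2 (Nat.succ_pos n)⟩
  have hMt : M ≠ ⊤ := ENNReal.ofReal_ne_top
  have hβt : β ≠ ⊤ := ENNReal.ofReal_ne_top
  set w : ℝ → ℝ≥0∞ := fun t => ENNReal.ofReal ((1 - t ^ 2) ^ n) with hw
  have hwm : Measurable w := (by fun_prop : Measurable fun t : ℝ => (1 - t ^ 2) ^ n).ennreal_ofReal
  have hbound : ∀ a, 0 < a → a ≤ r → ∀ t ∈ Ioo (-1 : ℝ) 1,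
      ∫⁻ s, ennrealKernel n t s * (w s ^ (1 / r)) ^ a ∂intervalMeasure
        ≤ β ^ (a / r) * M ^ (1 - a / r) * (w t ^ (1 / r)) ^ a := by
    intro a ha har t ht
    have h := lintegral_mul_rpow_le_of_le (measurable_ennrealKernel_right n t) hwm
      (lintegral_ennrealKernel_le hn ht) (lintegral_ennrealKernel_mul_weight_le hn ht)
      (θ := a / r) (by positivity) ((div_le_one hr).2 har)
    simp only [← ENNReal.rpow_mul, one_div_mul_eq_div]
    refine h.trans (le_of_eq ?_)
    rw [ENNReal.mul_rpow_of_nonneg _ _ (by positivity)]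
    ring
  refine eLpNorm_solutionOperator_le_of_schur hn hp1 hp2 hpq (h := fun t => w t ^ (1 / r))
    (hwm.pow_const _) ?_ ?_ (hbound q hQ hqr) (hbound _ hP hpr) ?_ hf
  · intro t ht
    have h0 : w t ≠ 0 := by
      rw [hw, Ne, ENNReal.ofReal_eq_zero, not_le]
      exact pow_pos (one_sub_sq_mem ht).1 n
    exact (ENNReal.rpow_pos (pos_iff_ne_zero.2 h0) ENNReal.ofReal_ne_top).ne'
  · intro t ht
    exact ENNReal.rpow_ne_top_of_nonneg (by positivity) ENNReal.ofReal_ne_top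
  · refine le_of_eq ?_
    rw [ENNReal.mul_rpow_of_nonneg _ _ (by positivity), ENNReal.mul_rpow_of_nonneg _ _ hP.le]
    simp only [← ENNReal.rpow_mul]
    rw [mul_mul_mul_comm, ← ENNReal.rpow_add _ _ hβ0 hβt, ← ENNReal.rpow_add _ _ hM0 hMt]
    -- With p/q = p-1, the exponents add up to 2p/r for β and p - 2p/r for M.
    have hc := hpq.div_conj_eq_sub_one
    congr 2
    · field_simp; ring
    · rw [sub_mul, one_mul, show q / r * (p.toReal / q) = p.toReal / r by field_simp, hc]
      ring

theorem solutionOpNorm_le {n : ℕ} {p C : ℝ≥0∞}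
    (h : ∀ f : ℝ → 𝕜, MemLp f p intervalMeasure →
      eLpNorm (solutionOperator n f) p intervalMeasure ≤ C * eLpNorm f p intervalMeasure) :
    solutionOpNorm 𝕜 n p ≤ C := by
  refine iSup_le fun f => iSup_le fun hf => iSup_le fun hf1 => (h f hf).trans ?_
  exact mul_le_of_le_one_right' hf1

theorem le_solutionOpNorm {n : ℕ} {p c : ℝ≥0∞} {f : ℝ → 𝕜} (hf : MemLp f p intervalMeasure)
    (h0 : eLpNorm f p intervalMeasure ≠ 0)
    (h : c * eLpNorm f p intervalMeasure ≤ eLpNorm (solutionOperator n f) p intervalMeasure) :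
    c ≤ solutionOpNorm 𝕜 n p := by
  have htop := hf.2.ne
  set N := eLpNorm f p intervalMeasure with hN
  set a : 𝕜 := ((N.toReal⁻¹ : ℝ) : 𝕜) with ha
  have hpos : 0 < N.toReal := ENNReal.toReal_pos h0 htop
  have hae : ‖a‖ₑ = N⁻¹ := by
    rw [ha, ← ofReal_norm, RCLike.norm_ofReal, abs_of_pos (inv_pos.2 hpos),
      ENNReal.ofReal_inv_of_pos hpos, ENNReal.ofReal_toReal htop]
  have h1 : solutionOperator n (a • f) = a • solutionOperator n f := by
    funext t
    simp only [solutionOperator, Pi.smul_apply, smul_eq_mul]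
    rw [← integral_const_mul]
    congr 1
    funext s
    ring
  have h2 : eLpNorm (a • f) p intervalMeasure ≤ 1 := by
    rw [eLpNorm_const_smul, hae, ENNReal.inv_mul_cancel h0 htop]
  have h3 : c ≤ eLpNorm (solutionOperator n (a • f)) p intervalMeasure := by
    rw [h1, eLpNorm_const_smul, hae]
    calc c = N⁻¹ * (c * N) := by
          rw [mul_comm c, ← mul_assoc, ENNReal.inv_mul_cancel h0 htop, one_mul]
      _ ≤ _ := by gcongr
  exact h3.trans (le_iSup_of_le (a • f) (le_iSup_of_le (hf.const_smul a) (le_iSup_of_le h2 le_rfl)))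

theorem solutionOpNorm_le_inv_factorial {n : ℕ} (hn : 1 ≤ n) {p : ℝ≥0∞} (hp : 1 ≤ p) :
    solutionOpNorm 𝕜 n p ≤ ENNReal.ofReal (1 / (2 * n)!) :=
  solutionOpNorm_le fun _ hf => eLpNorm_solutionOperator_le hn hp hf.1

end Operator

/-! ### Lower bounds and exact norms -/

theorem intervalMeasure_ne_zero : intervalMeasure ≠ 0 := by
  simp [intervalMeasure]

theorem eLpNorm_ofReal_ne_zero {𝕜 : Type*} [RCLike 𝕜] {g : ℝ → ℝ} (hg : Continuous g)
    (hpos : ∀ s ∈ Ioo (-1 : ℝ) 1, 0 < g s) {p : ℝ≥0∞} (hp : p ≠ 0) :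
    eLpNorm (fun s => (g s : 𝕜)) p intervalMeasure ≠ 0 := by
  have hm : AEStronglyMeasurable (fun s => (g s : 𝕜)) intervalMeasure :=
    (RCLike.continuous_ofReal.comp hg).aestronglyMeasurable
  rw [Ne, eLpNorm_eq_zero_iff hm hp]
  intro h
  have hfalse : ∀ᵐ s ∂intervalMeasure, False := by
    filter_upwards [h, ae_intervalMeasure hpos] with s hs hs'
    have h0 : g s = 0 := by simpa using hs
    exact hs'.ne' h0
  exact intervalMeasure_ne_zero (ae_eq_bot.1 (Filter.eventually_false_iff_eq_bot.1 hfalse))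

theorem memLp_ofReal {𝕜 : Type*} [RCLike 𝕜] {g : ℝ → ℝ} (hg : Continuous g) (p : ℝ≥0∞) :
    MemLp (fun s => (g s : 𝕜)) p intervalMeasure := by
  obtain ⟨C, hC⟩ := (isCompact_Icc (a := (-1 : ℝ)) (b := 1)).exists_bound_of_continuousOn
    hg.continuousOn
  refine MemLp.of_bound (RCLike.continuous_ofReal.comp hg).aestronglyMeasurable C
    (ae_intervalMeasure fun s hs => ?_)
  rw [RCLike.norm_ofReal]
  exact hC s (Ioo_subset_Icc_self hs)

/-- The test function is w = (1-s²)^n: the inequality T_n w ≥ α_n w is pointwise, hence survives in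
every L^p norm. -/
theorem greenConstant_le_solutionOpNorm (𝕜 : Type*) [RCLike 𝕜] {n : ℕ} (hn : 1 ≤ n) {p : ℝ≥0∞}
    (hp : 1 ≤ p) : ENNReal.ofReal (greenConstant n) ≤ solutionOpNorm 𝕜 n p := by
  have hw : Continuous fun s : ℝ => (1 - s ^ 2) ^ n := by fun_prop
  have hp0 : p ≠ 0 := (zero_lt_one.trans_le hp).ne'
  refine le_solutionOpNorm (memLp_ofReal hw p)
    (eLpNorm_ofReal_ne_zero hw (fun s hs => pow_pos (one_sub_sq_mem hs).1 n) hp0) ?_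
  have hα : ENNReal.ofReal (greenConstant n) = ‖(greenConstant n : ℝ)‖ₑ := by
    rw [← ofReal_norm, Real.norm_of_nonneg (greenConstant_pos n).le]
  rw [hα, ← eLpNorm_const_smul]
  refine eLpNorm_mono_enorm_ae (ae_intervalMeasure fun t ht => ?_)
  have hwt := pow_nonneg (one_sub_sq_mem ht).1.le n
  rw [enorm_solutionOperator_ofReal hn (fun s hs => pow_nonneg (one_sub_sq_mem hs).1.le n) ht,
    Pi.smul_apply, enorm_smul, ← hα, ← ofReal_norm ((((1 - t ^ 2) ^ n : ℝ)) : 𝕜),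
    RCLike.norm_ofReal, abs_of_nonneg hwt, ← ENNReal.ofReal_mul (greenConstant_pos n).le]
  exact ENNReal.ofReal_le_ofReal (le_integral_boggioKernel_mul_one_sub_sq_pow hn ht)

/-- T_n 1 reaches 1/(2n)! only at t = 0, so both endpoint lower bounds are first obtained on (-ε, ε)
and then pass to the limit ε → 0. -/
theorem le_of_forall_one_sub_sq_pow_le {n : ℕ} {E : ℝ≥0∞}
    (h : ∀ ε ∈ Ioo (0 : ℝ) 1, ENNReal.ofReal ((1 - ε ^ 2) ^ n / (2 * n)!) ≤ E) :
    ENNReal.ofReal (1 / (2 * n)!) ≤ E := by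
  have hc : Continuous fun ε : ℝ => ENNReal.ofReal ((1 - ε ^ 2) ^ n / (2 * n)!) :=
    ENNReal.continuous_ofReal.comp (by fun_prop)
  have ht := (hc.tendsto 0).mono_left (nhdsWithin_le_nhds (s := Ioi 0))
  simp only [ne_eq, OfNat.ofNat_ne_zero, not_false_eq_true, zero_pow, sub_zero, one_pow] at ht
  refine le_of_tendsto ht ?_
  filter_upwards [Ioo_mem_nhdsGT (zero_lt_one' ℝ)] with ε hε using h ε hε

theorem one_sub_sq_pow_div_anti {n : ℕ} {ε s : ℝ} (hε : ε ∈ Ioo (0 : ℝ) 1)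
    (hs : s ∈ Ioo (-ε) ε) : (1 - ε ^ 2) ^ n / ((2 * n)! : ℝ) ≤ (1 - s ^ 2) ^ n / (2 * n)! := by
  have h1 : s ^ 2 ≤ ε ^ 2 := by nlinarith [hs.1, hs.2]
  have h2 : 0 ≤ 1 - ε ^ 2 := by nlinarith [hε.1, hε.2]
  gcongr

theorem inv_factorial_le_solutionOpNorm_top (𝕜 : Type*) [RCLike 𝕜] {n : ℕ} (hn : 1 ≤ n) :
    ENNReal.ofReal (1 / (2 * n)!) ≤ solutionOpNorm 𝕜 n ∞ := by
  refine le_solutionOpNorm (memLp_ofReal (g := fun _ => 1) continuous_const ∞)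
    (eLpNorm_ofReal_ne_zero continuous_const (fun _ _ => zero_lt_one) (by simp)) ?_
  have h1 : eLpNorm (fun _ : ℝ => ((1 : ℝ) : 𝕜)) ∞ intervalMeasure = 1 := by
    rw [eLpNorm_const _ (by simp) intervalMeasure_ne_zero]
    simp
  rw [h1, mul_one, eLpNorm_exponent_top]
  refine le_of_forall_one_sub_sq_pow_le fun ε hε => ?_
  have hsub : Ioo (-ε) ε ⊆ Ioo (-1 : ℝ) 1 :=
    Ioo_subset_Ioo (by linarith [hε.2]) hε.2.le
  have hae : ∀ᵐ t ∂volume.restrict (Ioo (-ε) ε),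
      ‖solutionOperator n (fun _ : ℝ => ((1 : ℝ) : 𝕜)) t‖ₑ
        ≤ eLpNormEssSup (solutionOperator n (fun _ : ℝ => ((1 : ℝ) : 𝕜))) intervalMeasure :=
    (ae_mono (Measure.restrict_mono hsub le_rfl)) (enorm_ae_le_eLpNormEssSup _ _)
  have hne : (ae (volume.restrict (Ioo (-ε) ε))).NeBot := by
    rw [ae_neBot]
    simpa using hε.1
  obtain ⟨t, ht1, ht2⟩ := (hae.and (ae_restrict_mem measurableSet_Ioo)).exists
  refine le_trans ?_ ht1
  rw [enorm_solutionOperator_ofReal hn (fun _ _ => zero_le_one) (hsub ht2)]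
  simp only [mul_one]
  rw [integral_boggioKernel hn (hsub ht2)]
  exact ENNReal.ofReal_le_ofReal (one_sub_sq_pow_div_anti hε ht2)

theorem inv_factorial_le_solutionOpNorm_one (𝕜 : Type*) [RCLike 𝕜] {n : ℕ} (hn : 1 ≤ n) :
    ENNReal.ofReal (1 / (2 * n)!) ≤ solutionOpNorm 𝕜 n 1 := by
  refine le_of_forall_one_sub_sq_pow_le fun ε hε => ?_
  have hsub : Ioo (-ε) ε ⊆ Ioo (-1 : ℝ) 1 :=
    Ioo_subset_Ioo (by linarith [hε.2]) hε.2.le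
  -- An L^1 test function concentrated near 0, where T_n 1 is largest.
  set g : ℝ → ℝ := (Ioo (-ε) ε).indicator fun _ => 1 with hg
  have hg0 : ∀ s, 0 ≤ g s := fun s => indicator_nonneg (fun _ _ => zero_le_one) s
  have hg1 : ∀ s, g s ≤ 1 := fun s => indicator_le_self' (fun _ _ => zero_le_one) s
  have hgm : Measurable g := measurable_const.indicator measurableSet_Ioo
  have henorm : ∀ s, ‖(g s : 𝕜)‖ₑ = ENNReal.ofReal (g s) := fun s => by
    rw [← ofReal_norm, RCLike.norm_ofReal, abs_of_nonneg (hg0 s)]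
  have hnorm : eLpNorm (fun s => (g s : 𝕜)) 1 intervalMeasure
      = ∫⁻ s, ENNReal.ofReal (g s) ∂intervalMeasure := by
    rw [eLpNorm_one_eq_lintegral_enorm]
    exact lintegral_congr henorm
  have hmem : MemLp (fun s => (g s : 𝕜)) 1 intervalMeasure :=
    MemLp.of_bound (RCLike.measurable_ofReal.comp hgm).aestronglyMeasurable 1
      (Filter.Eventually.of_forall fun s => by
        rw [RCLike.norm_ofReal, abs_of_nonneg (hg0 s)]; exact hg1 s)
  refine le_solutionOpNorm hmem ?_ ?_
  · rw [hnorm]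
    have h1 : ∀ s, ENNReal.ofReal (g s) = (Ioo (-ε) ε).indicator 1 s := fun s => by
      by_cases hs : s ∈ Ioo (-ε) ε <;> simp [hg, hs]
    simp only [h1]
    rw [lintegral_indicator_one measurableSet_Ioo, intervalMeasure,
      Measure.restrict_apply measurableSet_Ioo, inter_eq_left.2 hsub, Real.volume_Ioo,
      Ne, ENNReal.ofReal_eq_zero, not_le]
    linarith [hε.1]
  · rw [hnorm, eLpNorm_one_eq_lintegral_enorm]
    have h2 : ∫⁻ t, ‖solutionOperator n (fun s => (g s : 𝕜)) t‖ₑ ∂intervalMeasure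
        = ∫⁻ t, ∫⁻ s, ennrealKernel n t s * ENNReal.ofReal (g s) ∂intervalMeasure
            ∂intervalMeasure := by
      refine lintegral_congr_ae (ae_intervalMeasure fun t ht => ?_)
      simp only
      rw [enorm_solutionOperator_ofReal hn (fun s _ => hg0 s) ht,
        lintegral_ennrealKernel_mul ht (fun s _ => hg0 s)]
      refine (continuous_boggioKernel_right n t).integrable_intervalMeasure.mul_bdd (c := 1)
        hgm.aestronglyMeasurable (Filter.Eventually.of_forall fun s => ?_)
      rw [Real.norm_of_nonneg (hg0 s)]
      exact hg1 s
    rw [h2, lintegral_lintegral_ennrealKernel_mul n hgm.ennreal_ofReal.aemeasurable,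
      ← lintegral_const_mul _ hgm.ennreal_ofReal]
    refine lintegral_mono_ae (ae_intervalMeasure fun s hs => ?_)
    rw [lintegral_ennrealKernel hn hs]
    by_cases hsε : s ∈ Ioo (-ε) ε
    · exact mul_le_mul_left (ENNReal.ofReal_le_ofReal (one_sub_sq_pow_div_anti hε hsε)) _
    · simp [hg, hsε]

theorem solutionOpNorm_top (𝕜 : Type*) [RCLike 𝕜] {n : ℕ} (hn : 1 ≤ n) :
    solutionOpNorm 𝕜 n ∞ = ENNReal.ofReal (1 / (2 * n)!) :=
  le_antisymm (solutionOpNorm_le_inv_factorial hn le_top) (inv_factorial_le_solutionOpNorm_top 𝕜 hn)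

theorem solutionOpNorm_one (𝕜 : Type*) [RCLike 𝕜] {n : ℕ} (hn : 1 ≤ n) :
    solutionOpNorm 𝕜 n 1 = ENNReal.ofReal (1 / (2 * n)!) :=
  le_antisymm (solutionOpNorm_le_inv_factorial hn le_rfl) (inv_factorial_le_solutionOpNorm_one 𝕜 hn)

/-! ### Assembling the two-sided bounds -/

/-- Since b_n = √2 (2n)! R_n α_n, the factor 2^(1/r) is exactly the power of √2 that has to be
cancelled. -/
theorem upperFactor_rpow_div {n : ℕ} (hn : 1 ≤ n) (r : ℝ) :
    ENNReal.ofReal (upperFactor n ^ (2 / r) / ((2 * n)! * 2 ^ (1 / r)))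
      = ENNReal.ofReal (hypergeometricRatio n * greenConstant n) ^ (2 / r) *
        ENNReal.ofReal (1 / (2 * n)!) ^ (1 - 2 / r) := by
  have hR : 0 < hypergeometricRatio n := Finset.sum_pos (fun k hk =>
      hypergeometricTerm_pos hn (Nat.lt_succ_iff.1 (Finset.mem_range.1 hk)))
      ⟨0, Finset.mem_range.2 (Nat.succ_pos n)⟩
  have hβ : 0 < hypergeometricRatio n * greenConstant n := mul_pos hR (greenConstant_pos n)
  have hf : (0 : ℝ) < (2 * n)! := by positivity
  rw [ENNReal.ofReal_rpow_of_pos hβ, ENNReal.ofReal_rpow_of_pos (by positivity),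
    ← ENNReal.ofReal_mul (by positivity)]
  congr 1
  have h1 : upperFactor n = √2 * ((2 * n)! * (hypergeometricRatio n * greenConstant n)) := by
    rw [upperFactor, lowerFactor_eq]; ring
  have h2 : (√2 : ℝ) ^ (2 / r) = 2 ^ (1 / r) := by
    rw [Real.sqrt_eq_rpow, ← Real.rpow_mul (by norm_num)]
    congr 1
    ring
  rw [h1, Real.mul_rpow (by positivity) (by positivity), h2, Real.mul_rpow hf.le hβ.le,
    one_div ((2 * n)! : ℝ), Real.inv_rpow hf.le, Real.rpow_sub hf, Real.rpow_one]
  have h3 : (0 : ℝ) < 2 ^ (1 / r) := by positivity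
  have h4 : (0 : ℝ) < ((2 * n)! : ℝ) ^ (2 / r) := by positivity
  field_simp

theorem solutionOpNorm_le_upperFactor (𝕜 : Type*) [RCLike 𝕜] {n : ℕ} (hn : 1 ≤ n)
    {p q : ℝ≥0∞} (hpq : 1 / p + 1 / q = 1) :
    solutionOpNorm 𝕜 n p ≤ ENNReal.ofReal (upperFactor n ^ (2 / max p q).toReal /
      ((2 * n)! * 2 ^ (1 / max p q).toReal)) := by
  have hpq' : p⁻¹ + q⁻¹ = 1 := by simpa [one_div] using hpq
  have hp : 1 ≤ p := ENNReal.inv_le_one.1 (hpq' ▸ le_self_add)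
  have hq : 1 ≤ q := ENNReal.inv_le_one.1 (hpq' ▸ le_add_self)
  -- At r = ∞ both exponents are 0, so the claim is the general bound 1/(2n)!; Schur's test covers
  -- the rest.
  rcases eq_or_ne (max p q) ∞ with h | h
  · rw [h]
    simpa using solutionOpNorm_le_inv_factorial (𝕜 := 𝕜) hn hp
  have hpt : p ≠ ∞ := fun hh => h (by simp [hh])
  have hqt : q ≠ ∞ := fun hh => h (by simp [hh])
  have hp0 : p ≠ 0 := (zero_lt_one.trans_le hp).ne'
  have hq0 : q ≠ 0 := (zero_lt_one.trans_le hq).ne'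
  have hconj : p.toReal.HolderConjugate q.toReal := by
    refine ⟨?_, ENNReal.toReal_pos hp0 hpt, ENNReal.toReal_pos hq0 hqt⟩
    have := congrArg ENNReal.toReal hpq'
    rw [ENNReal.toReal_add (ENNReal.inv_ne_top.2 hp0) (ENNReal.inv_ne_top.2 hq0)] at this
    simpa [ENNReal.toReal_inv] using this
  have h2 : (2 / max p q).toReal = 2 / (max p q).toReal := by simp [ENNReal.toReal_div]
  have h1 : (1 / max p q).toReal = 1 / (max p q).toReal := by simp
  rw [h1, h2, upperFactor_rpow_div hn]
  exact solutionOpNorm_le fun f hf => eLpNorm_solutionOperator_le_interpolated hn hp0 hpt hconj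
    (ENNReal.toReal_mono h (le_max_left _ _)) (ENNReal.toReal_mono h (le_max_right _ _)) hf.1

theorem one_le_of_one_div_add_one_div {p q : ℝ≥0∞} (hpq : 1 / p + 1 / q = 1) : 1 ≤ p := by
  rw [one_div, one_div] at hpq
  exact ENNReal.inv_le_one.1 (hpq ▸ le_self_add)

theorem lowerFactor_div (n : ℕ) : lowerFactor n / (√2 * (2 * n)!) = greenConstant n := by
  rw [lowerFactor_eq]
  exact mul_div_cancel_left₀ _ (by positivity)

/-- Crude constants: a_n² ≥ 1/2 gives a_n ≥ 1/2, and √2 ≤ 2 supplies the other factor 1/2. -/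
theorem quarter_div_factorial_le_greenConstant {n : ℕ} (hn : 1 ≤ n) :
    1 / 4 * (1 / ((2 * n)! : ℝ)) ≤ greenConstant n := by
  have hn' : (1 : ℝ) ≤ n := by exact_mod_cast hn
  have h1 := (lowerFactor_sq_bounds hn).1
  have h2 : (1 / 2 : ℝ) ≤ n / (n + 1 / 2) := by
    rw [div_le_div_iff₀ (by norm_num) (by positivity)]; linarith
  have h3 : (1 / 2 : ℝ) ≤ lowerFactor n := by nlinarith [lowerFactor_pos n]
  have h4 : √2 ≤ (2 : ℝ) := by
    rw [Real.sqrt_le_left (by norm_num)]; norm_num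
  rw [← lowerFactor_div, one_div_mul_one_div, div_le_div_iff₀ (by positivity) (by positivity)]
  have hf : (0 : ℝ) < (2 * n)! := by positivity
  nlinarith [mul_le_mul_of_nonneg_right h4 hf.le, mul_le_mul_of_nonneg_right h3 hf.le]

/-! ### Derivatives of test functions -/

theorem IsTestFunction.iteratedDeriv_eq_zero {𝕜 : Type*} [RCLike 𝕜] {h : ℝ → 𝕜}
    (hh : IsTestFunction h) {x : ℝ} (hx : x ∉ Ioo (-1 : ℝ) 1) (j : ℕ) :
    iteratedDeriv j h x = 0 := by
  have h1 : h =ᶠ[nhds x] fun _ => 0 :=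
    notMem_tsupport_iff_eventuallyEq.1 fun hx' => hx (hh.2.2 hx')
  rw [h1.iteratedDeriv_eq j]
  simp

theorem factorial_le_integral_norm_iteratedDeriv {𝕜 : Type*} [RCLike 𝕜] {n : ℕ} (hn : 1 ≤ n)
    {h : ℝ → 𝕜} (hh : IsTestFunction h) (h1 : ∫ t, ‖h t‖ ∂intervalMeasure = 1) :
    ((2 * n)! : ℝ) ≤ ∫ t, ‖iteratedDeriv (2 * n) h t‖ ∂intervalMeasure := by
  set f : ℝ → 𝕜 := fun t => (-1) ^ n * iteratedDeriv (2 * n) h t with hf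
  have hD : Continuous (iteratedDeriv (2 * n) h) := hh.1.continuous_iteratedDeriv_of_top _
  have hfc : Continuous f := continuous_const.mul hD
  -- A test function vanishes to all orders at ±1, so the representation formula recovers it from
  -- `f`; the L^1 bound for T_n is then read backwards.
  have hT : ∀ t ∈ Ioo (-1 : ℝ) 1, solutionOperator n f t = h t := fun t ht => by
    rw [solutionOperator_eq hn f ht]
    exact integral_boggioKernel_mul_iteratedDeriv hn hh.1
      (fun j _ => hh.iteratedDeriv_eq_zero (by simp) j)
      (fun j _ => hh.iteratedDeriv_eq_zero (by simp) j) ht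
  have h2 := eLpNorm_one_solutionOperator_le hn (f := f) hfc.aestronglyMeasurable
  rw [eLpNorm_congr_ae (ae_intervalMeasure hT), eLpNorm_one_eq_lintegral_enorm,
    eLpNorm_one_eq_lintegral_enorm] at h2
  have h3 : ∀ t, ‖f t‖ₑ = ‖iteratedDeriv (2 * n) h t‖ₑ := fun t => by
    simp [hf, enorm_mul, enorm_pow]
  simp only [h3] at h2
  have h4 := ENNReal.toReal_mono (ENNReal.mul_ne_top ENNReal.ofReal_ne_top
    (hD.integrable_intervalMeasure.2).ne) h2
  rw [ENNReal.toReal_mul, ENNReal.toReal_ofReal (by positivity),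
    ← integral_norm_eq_lintegral_enorm hh.1.continuous.aestronglyMeasurable,
    ← integral_norm_eq_lintegral_enorm hD.aestronglyMeasurable, h1, one_div_mul_eq_div,
    le_div_iff₀ (by positivity), one_mul] at h4
  exact h4


theorem mainTheorem4 (𝕜 : Type*) [RCLike 𝕜] :
    -- `T_n` acts on every `L^p(-1,1)`
    (∀ n : ℕ, 1 ≤ n → ∀ p : ℝ≥0∞, 1 ≤ p → ∀ f : ℝ → 𝕜, MemLp f p intervalMeasure →
      MemLp (solutionOperator n f) p intervalMeasure) ∧
    -- the exact norms for `p = ∞` and `p = 1`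
    (∀ n : ℕ, 1 ≤ n →
      solutionOpNorm 𝕜 n ∞ = ENNReal.ofReal (1 / (2 * n)!) ∧
      solutionOpNorm 𝕜 n 1 = ENNReal.ofReal (1 / (2 * n)!)) ∧
    -- the two-sided bound for all `p`, with factors tending to `1`
    Filter.Tendsto lowerFactor Filter.atTop (nhds 1) ∧
    Filter.Tendsto upperFactor Filter.atTop (nhds 1) ∧
    (∀ n : ℕ, 1 ≤ n → ∀ p q r : ℝ≥0∞, 1 / p + 1 / q = 1 → r = max p q →
      ENNReal.ofReal (lowerFactor n / (√2 * (2 * n)!)) ≤ solutionOpNorm 𝕜 n p ∧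
      solutionOpNorm 𝕜 n p ≤
        ENNReal.ofReal (upperFactor n ^ (2 / r).toReal / ((2 * n)! * 2 ^ (1 / r).toReal))) ∧
    -- `‖T_n‖_{p,p} ≍ 1/(2n)!`
    (∃ c C : ℝ, 0 < c ∧ 0 < C ∧ ∀ n : ℕ, 1 ≤ n → ∀ p : ℝ≥0∞, 1 ≤ p →
      ENNReal.ofReal (c * (1 / (2 * n)!)) ≤ solutionOpNorm 𝕜 n p ∧
      solutionOpNorm 𝕜 n p ≤ ENNReal.ofReal (C * (1 / (2 * n)!))) ∧
    -- the lower bound for derivatives of test functions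
    (∀ n : ℕ, 1 ≤ n → ∀ h : ℝ → 𝕜, IsTestFunction h → ∫ t, ‖h t‖ ∂intervalMeasure = 1 →
      ((2 * n)! : ℝ) ≤ ∫ t, ‖iteratedDeriv (2 * n) h t‖ ∂intervalMeasure) := by
  refine ⟨fun n hn p hp f hf => memLp_solutionOperator hn hp hf,
    fun n hn => ⟨solutionOpNorm_top 𝕜 hn, solutionOpNorm_one 𝕜 hn⟩, tendsto_lowerFactor,
    tendsto_upperFactor, ?_, ⟨1 / 4, 1, by norm_num, one_pos, fun n hn p hp => ⟨?_, ?_⟩⟩,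
    fun n hn h hh h1 => factorial_le_integral_norm_iteratedDeriv hn hh h1⟩
  · rintro n hn p q r hpq rfl
    refine ⟨?_, solutionOpNorm_le_upperFactor 𝕜 hn hpq⟩
    rw [lowerFactor_div]
    exact greenConstant_le_solutionOpNorm 𝕜 hn (one_le_of_one_div_add_one_div hpq)
  · exact (ENNReal.ofReal_le_ofReal (quarter_div_factorial_le_greenConstant hn)).trans
      (greenConstant_le_solutionOpNorm 𝕜 hn hp)
  · rw [one_mul]
    exact solutionOpNorm_le_inv_factorial hn hp
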